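/- Fix a real number $0<p<1$, an integer $L\ge 0$ and $\gamma,\tau\in\mathbb{C}$, and put $$[x]=\tfrac12\sum_{n\in\mathbb{Z}}(-1)^{n-1/2}\,p^{(n+1/2)^2}e^{-(2n+1)x}\qquad(x\in\mathbb{C}).$$ Let $x_1,\dots,x_L,\mu_1,\dots,\mu_L\in\mathbb{C}$. The partition function of the 8VSOS model with domain-wall boundaries is $$\mathcal{Z}_\tau(x_1,\dots,x_L)=\sum_{\{h_{i,j}\}}\ \prod_{i,j=1}^{L}w_{ij}\begin{pmatrix}h_{i+1,j}&h_{i+1,j+1}\\ h_{i,j}&h_{i,j+1}\end{pmatrix},$$ where the sum is over all families $h_{i,j}=\tau+n_{i,j}\gamma$ ($n_{i,j}\in\mathbb{Z}$, $1\le i,j\le L+1$) such that $|n_{i,j}-n_{i',j'}|=1$ for neighbouring lattice points $(i,j)$, $(i',j')$, with boundary values $h_{1,j}=h_{j,1}=\tau+(L+1-j)\gamma$ and $h_{L+1,j}=h_{j,L+1}=\tau+(j-1)\gamma$. Neighbouring heights differ by $\pm\gamma$, and the weights are, for a height $h=\tau+n\gamma$ and $s=h+\gamma$, $$w_{ij}\begin{pmatrix}h\pm\gamma&h\\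 h&h\mp\gamma\end{pmatrix}=[x_i-\mu_j+\gamma],\quad w_{ij}\begin{pmatrix}h&h\pm\gamma\\ h\mp\gamma&h\end{pmatrix}=\frac{[s\pm\gamma][x_i-\mu_j]}{[s]},\quad w_{ij}\begin{pmatrix}h&h\mp\gamma\\ h\mp\gamma&h\end{pmatrix}=\frac{[s\pm(x_i-\mu_j)][\gamma]}{[s]}$$ (configurations are indexed by the integers $n_{i,j}$, and plaquettes are distinguished by them). Let $x_0,x_{\bar 0}\in\mathbb{C}$, write $\mathrm{X}=(x_1,\dots,x_L)$, and for $\alpha\in\{0,\bar 0\}$ let $\mathrm{X}_i^{\alpha}$ be $\mathrm{X}$ with $x_i$ replaced by $x_\alpha$. Assume that no denominator vanishes: $[\tau+k\gamma]\ne0$ for $1\le k\le L$; $[x_i-x_j]\neq 0$ for $i\ne j$ in $\{1,\dots,L\}$; and $[x_j-x_0]$, $[x_j-x_{\bar 0}]$, $[x_0-\mu_j]$, $[x_{\bar 0}-\mu_j]$ are nonzero for $1\le j\le L$. Then $$\mathcal{M}_0\,\mathcal{Z}_\tau(\mathrm{X})+\sum_{i=1}^L\mathcal{N}_i\,\mathcal{Z}_\tau(\mathrm{X}_i^0)+\sum_{i=1}^L\bar{\mathcal{N}}_i\,\mathcal{Z}_\tau(\mathrm{X}_i^{\bar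 0})=0,$$ where $$\mathcal{M}_0=\prod_{j=1}^L\frac{[x_{\bar0}-\mu_j+\gamma][x_j-x_{\bar0}+\gamma]}{[x_{\bar0}-\mu_j][x_j-x_{\bar0}]}-\prod_{j=1}^L\frac{[x_0-\mu_j+\gamma][x_j-x_0+\gamma]}{[x_0-\mu_j][x_j-x_0]},$$ $$\mathcal{N}_i=\frac{[\gamma][\tau+\gamma+x_0-x_i]}{[\tau+\gamma][x_i-x_0]}\prod_{j=1}^L\frac{[x_i-\mu_j+\gamma]}{[x_0-\mu_j]}\prod_{\substack{j=1\\ j\ne i}}^L\frac{[x_j-x_i+\gamma]}{[x_j-x_i]},$$ $$\bar{\mathcal{N}}_i=\frac{[\gamma][\tau+\gamma+x_{\bar0}-x_i]}{[\tau+\gamma][x_{\bar0}-x_i]}\prod_{j=1}^L\frac{[x_i-\mu_j+\gamma]}{[x_{\bar0}-\mu_j]}\prod_{\substack{j=1\\ j\ne i}}^L\frac{[x_j-x_i+\gamma]}{[x_j-x_i]}.$$ -/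

import Mathlib

namespace SOS

noncomputable section

/-- The theta function
`[x] = (1/2) ∑_{n ∈ ℤ} (-1)^(n - 1/2) p^((n + 1/2)^2) exp (-(2 n + 1) x)` of elliptic nome `p`. -/
def theta (p : ℝ) (x : ℂ) : ℂ :=
  (1 / 2) * ∑' n : ℤ, (-1 : ℂ) ^ ((n : ℂ) - 1 / 2) * ((p ^ (((n : ℝ) + 1 / 2) ^ 2) : ℝ) : ℂ) *
    Complex.exp (-(2 * (n : ℂ) + 1) * x)

/-- The weight of a plaquette whose corner heights are `τ + a γ`, `τ + b γ` (top row of the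
height matrix) and `τ + c γ`, `τ + d γ` (bottom row), with `u` the difference between the spectral
and the inhomogeneity parameter. When neighbouring heights differ by `±γ`, the three branches
below are the only possible plaquettes:
* `a ≠ d`, which forces `b = c` : the weight is `[u + γ]`;
* `a = d` and `b = c = a ∓ 1` : the weight is `[s ± u] [γ] / [s]`;
* `a = d`, `c = a ∓ 1` and `b = a ± 1` : the weight is `[s ± γ] [u] / [s]`;
here `s = τ + (a + 1) γ`. -/
def weight (p : ℝ) (γ τ u : ℂ) (a b c d : ℤ) : ℂ :=
  if a ≠ d then theta p (u + γ)
  else if b = c then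
    theta p (τ + ((a : ℂ) + 1) * γ + ((a : ℂ) - c) * u) * theta p γ /
      theta p (τ + ((a : ℂ) + 1) * γ)
  else
    theta p (τ + ((a : ℂ) + 1) * γ + ((a : ℂ) - c) * γ) * theta p u /
      theta p (τ + ((a : ℂ) + 1) * γ)

/-- The height configurations with domain-wall boundaries. The height at the lattice point
`(i, j)` is `τ + n i j * γ`; rows and columns are numbered `0, …, L`. -/
structure IsDomainWall (L : ℕ) (n : Fin (L + 1) → Fin (L + 1) → ℤ) : Prop where
  step_row : ∀ (i : Fin L) (j : Fin (L + 1)), |n i.succ j - n i.castSucc j| = 1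
  step_col : ∀ (i : Fin (L + 1)) (j : Fin L), |n i j.succ - n i j.castSucc| = 1
  first_row : ∀ j : Fin (L + 1), n 0 j = (L : ℤ) - j
  first_col : ∀ j : Fin (L + 1), n j 0 = (L : ℤ) - j
  last_row : ∀ j : Fin (L + 1), n (Fin.last L) j = j
  last_col : ∀ j : Fin (L + 1), n j (Fin.last L) = j

theorem finite_isDomainWall (L : ℕ) : {n | IsDomainWall L n}.Finite := by
  have key : ∀ n, IsDomainWall L n → ∀ i j, n i j ∈ Set.Icc (-(L : ℤ)) (2 * L) := by
    intro n hn i j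
    have h : |n i j - n 0 j| ≤ (i : ℕ) := by
      induction i using Fin.induction with
      | zero => simp
      | succ i ih =>
        have h1 := hn.step_row i j
        have h2 := abs_sub_le (n i.succ j) (n i.castSucc j) (n 0 j)
        simp only [Fin.val_castSucc, Fin.val_succ] at ih ⊢
        push_cast
        linarith
    rw [hn.first_row] at h
    have hi := i.is_lt
    have hj := j.is_lt
    rw [abs_le] at h
    constructor <;> omega
  have hfin : (Set.univ.pi fun _ : Fin (L + 1) => Set.univ.pi fun _ : Fin (L + 1) =>
      Set.Icc (-(L : ℤ)) (2 * L)).Finite :=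
    Set.Finite.pi fun _ => Set.Finite.pi fun _ => Set.finite_Icc _ _
  exact hfin.subset fun n hn i _ j _ => key n hn i j

/-- The partition function `Z_τ(x₁, …, x_L | μ₁, …, μ_L)` of the 8VSOS model with domain-wall
boundaries: the sum over height configurations of the product of the plaquette weights. -/
def Z (p : ℝ) (γ τ : ℂ) {L : ℕ} (x μ : Fin L → ℂ) : ℂ :=
  ∑ n ∈ (finite_isDomainWall L).toFinset, ∏ i : Fin L, ∏ j : Fin L,
    weight p γ τ (x i - μ j)
      (n i.succ j.castSucc) (n i.succ j.succ) (n i.castSucc j.castSucc) (n i.castSucc j.succ)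

/-- The coefficient `M₀`; `x₀'` stands for the extra variable. -/
def coeffM (p : ℝ) (γ : ℂ) {L : ℕ} (x μ : Fin L → ℂ) (x₀ x₀' : ℂ) : ℂ :=
  ∏ j : Fin L, (theta p (x₀' - μ j + γ) * theta p (x j - x₀' + γ)) /
      (theta p (x₀' - μ j) * theta p (x j - x₀')) -
    ∏ j : Fin L, (theta p (x₀ - μ j + γ) * theta p (x j - x₀ + γ)) /
      (theta p (x₀ - μ j) * theta p (x j - x₀))

/-- The coefficient `N_i`. -/
def coeffN (p : ℝ) (γ τ : ℂ) {L : ℕ} (x μ : Fin L → ℂ) (x₀ : ℂ) (i : Fin L) : ℂ :=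
  (theta p γ * theta p (τ + γ + x₀ - x i)) / (theta p (τ + γ) * theta p (x i - x₀)) *
    (∏ j : Fin L, theta p (x i - μ j + γ) / theta p (x₀ - μ j)) *
    ∏ j ∈ Finset.univ.erase i, theta p (x j - x i + γ) / theta p (x j - x i)

/-- The coefficient `N̄_i`. -/
def coeffNbar (p : ℝ) (γ τ : ℂ) {L : ℕ} (x μ : Fin L → ℂ) (x₀' : ℂ) (i : Fin L) : ℂ :=
  (theta p γ * theta p (τ + γ + x₀' - x i)) / (theta p (τ + γ) * theta p (x₀' - x i)) *
    (∏ j : Fin L, theta p (x i - μ j + γ) / theta p (x₀' - μ j)) *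
    ∏ j ∈ Finset.univ.erase i, theta p (x j - x i + γ) / theta p (x j - x i)

end

end SOS

/-!
The functional equation is a consequence of the dynamical Yang–Baxter algebra of the 8VSOS model.

Write `[x]` for `theta p x`. The product `[x + y] [x - y]` has the form `f x * g y - g x * f y`
(`theta_add_mul_theta_sub`), so the Plücker relation of a `2 × 4` matrix gives the three-term
relation for `[·]`, and this in turn gives the local Yang–Baxter equation `yangBaxter` for the
plaquette weights. Applied column by column it exchanges two rows of a lattice at the price of
moving a crossing from the left boundary to the right one (`row_yangBaxter`).

Let `B x` be the operator that adds a row of spectral parameter `x` whose left height drops and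
whose right height rises, and `A x` the one where both rise. Then `Z` is a matrix element of
`B x₁ ⋯ B x_L` (`Z_eq_prodB`), the `B`s commute (`rowB_comm`), and moving `A y` from the top of
`B x₁ ⋯ B x_L` to the bottom produces a sum of terms with `A y` or `A x_i` at the bottom
(`prodB_rowA`). Now take the matrix element between the bottom profile `L - 1, …, 0, -1` and the
top profile `0, 1, …, L`. At either end the row `A` is frozen (`row_descending`,
`row_ascending`). At the bottom it yields the partition functions with the coefficients of the
theorem, while at the top it yields `∏ j, [y - μ j]` times a quantity that does not depend on `y`.
After division by that product, the sum attached to `y` is therefore the same for `y = x₀` and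
`y = x₀'` (`exists_common_value`), and this equality is the functional equation.

The intermediate steps meet heights outside `0, …, L`, so they need `[τ + k γ] ≠ 0` for all integers
`k`. Both sides are continuous at `τ` under the stated hypotheses (`continuousAt_Z`), and the generic
dynamical parameters are dense (`dense_generic`), which removes the restriction.
-/

namespace SOS

open Topology Filter

/-! ### The theta function: oddness, analyticity and the three-term relation -/

/-- The term `p ^ (a² / 2) * exp (-2 a x)` of the two theta series, one of them with signs
`(-1) ^ a`, into which products `[x + y] [x - y]` decompose. -/
noncomputable def thetaTerm (p : ℝ) (a : ℤ) (x : ℂ) : ℂ :=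
  Complex.exp ((Real.log p : ℂ) * (a : ℂ) ^ 2 / 2 - 2 * a * x)

theorem summable_thetaTerm {p : ℝ} (hp0 : 0 < p) (hp1 : p < 1) (x : ℂ) :
    Summable fun a : ℤ => ‖thetaTerm p a x‖ := by
  have hl : Real.log p < 0 := Real.log_neg hp0 hp1
  have h : Summable fun a : ℤ =>
      jacobiTheta₂_term a (Complex.I * x / Real.pi) (-Complex.I * Real.log p / (2 * Real.pi)) := by
    rw [summable_jacobiTheta₂_term_iff]
    have : (-Complex.I * Real.log p / (2 * Real.pi)) =
      ((-Real.log p / (2 * Real.pi) : ℝ) : ℂ) * Complex.I := by push_cast; ring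
    rw [this, Complex.im_ofReal_mul, Complex.I_im, mul_one]
    exact div_pos (by linarith) (by positivity)
  refine h.norm.congr fun a => ?_
  congr 1
  unfold jacobiTheta₂_term thetaTerm
  congr 1
  have hpi : (Real.pi : ℂ) ≠ 0 := by exact_mod_cast Real.pi_ne_zero
  field_simp
  linear_combination (4 * a * x - (Real.log p : ℂ) * a ^ 2) * Complex.I_sq

theorem thetaCoeff_eq {p : ℝ} (hp0 : 0 < p) (n : ℤ) :
    (-1 : ℂ) ^ ((n : ℂ) - 1 / 2) * ((p ^ (((n : ℝ) + 1 / 2) ^ 2) : ℝ) : ℂ) =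
      -Complex.I * (-1) ^ n * Complex.exp ((Real.log p : ℂ) * ((n : ℂ) + 1 / 2) ^ 2) := by
  rw [Complex.cpow_sub _ _ (by norm_num), Complex.cpow_intCast,
    Complex.ofReal_cpow hp0.le, Complex.cpow_def_of_ne_zero (x := (p : ℂ)) (by exact_mod_cast hp0.ne'),
    Complex.cpow_def_of_ne_zero (x := (-1 : ℂ)) (by norm_num), Complex.log_neg_one,
    ← Complex.ofReal_log hp0.le]
  have : Complex.exp (Real.pi * Complex.I * (1 / 2)) = Complex.I := by
    rw [show (Real.pi * Complex.I * (1 / 2) : ℂ) = Real.pi / 2 * Complex.I by ring,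
      Complex.exp_pi_div_two_mul_I]
  rw [this, div_eq_mul_inv, Complex.inv_I]
  push_cast
  ring

theorem theta_eq_tsum {p : ℝ} (hp0 : 0 < p) (x : ℂ) :
    theta p x = ∑' n : ℤ, -(Complex.I / 2) * (-1) ^ n *
      Complex.exp ((Real.log p : ℂ) * ((n : ℂ) + 1 / 2) ^ 2 - (2 * n + 1) * x) := by
  unfold theta
  rw [← tsum_mul_left]
  refine tsum_congr fun n => ?_
  rw [thetaCoeff_eq hp0, sub_eq_add_neg, Complex.exp_add, neg_mul]
  ring_nf

theorem theta_neg {p : ℝ} (hp0 : 0 < p) (x : ℂ) : theta p (-x) = -theta p x := by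
  rw [theta_eq_tsum hp0, theta_eq_tsum hp0, ← tsum_neg]
  let e : ℤ ≃ ℤ := (Equiv.addRight 1).trans (Equiv.neg ℤ)
  rw [← e.tsum_eq]
  refine tsum_congr fun n => ?_
  have h1 : (-1 : ℂ) ^ (e n) = -(-1) ^ n := by
    simp [e, zpow_add₀, ← inv_zpow]
  have h2 : ((e n : ℤ) : ℂ) = -n - 1 := by simp [e]; ring
  rw [h1, h2]
  ring_nf

theorem thetaSeriesTerm_eq (p : ℝ) (x : ℂ) (n : ℤ) :
    -(Complex.I / 2) * (-1) ^ n *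
      Complex.exp ((Real.log p : ℂ) * ((n : ℂ) + 1 / 2) ^ 2 - (2 * n + 1) * x) =
    -(Complex.I / 2) * Complex.exp (Real.log p / 4 - x) *
      jacobiTheta₂_term n (1 / 2 + (2 * x - Real.log p) * Complex.I / (2 * Real.pi))
        (-Complex.I * Real.log p / Real.pi) := by
  have hpi : (Real.pi : ℂ) ≠ 0 := by exact_mod_cast Real.pi_ne_zero
  have h : (-1 : ℂ) ^ n = Complex.exp (n * (Real.pi * Complex.I)) := by
    rw [Complex.exp_int_mul, Complex.exp_pi_mul_I]
  rw [h, jacobiTheta₂_term, mul_assoc, mul_assoc, ← Complex.exp_add, ← Complex.exp_add]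
  congr 2
  field_simp
  linear_combination (-32 * n * x + 16 * (Real.log p : ℂ) * n + 16 * n ^ 2 * (Real.log p : ℂ)) *
    Complex.I_sq

theorem theta_eq_jacobiTheta₂ {p : ℝ} (hp0 : 0 < p) (x : ℂ) :
    theta p x = -(Complex.I / 2) * Complex.exp (Real.log p / 4 - x) *
      jacobiTheta₂ (1 / 2 + (2 * x - Real.log p) * Complex.I / (2 * Real.pi))
        (-Complex.I * Real.log p / Real.pi) := by
  rw [theta_eq_tsum hp0, jacobiTheta₂, ← tsum_mul_left]
  exact tsum_congr fun n => thetaSeriesTerm_eq p x n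

theorem im_nome_pos {p : ℝ} (hp0 : 0 < p) (hp1 : p < 1) :
    0 < (-Complex.I * Real.log p / Real.pi).im := by
  have hl : Real.log p < 0 := Real.log_neg hp0 hp1
  have : (-Complex.I * Real.log p / Real.pi) =
    ((-Real.log p / Real.pi : ℝ) : ℂ) * Complex.I := by push_cast; ring
  rw [this, Complex.im_ofReal_mul, Complex.I_im, mul_one]
  exact div_pos (by linarith) (by positivity)

theorem differentiable_theta {p : ℝ} (hp0 : 0 < p) (hp1 : p < 1) :
    Differentiable ℂ (theta p) := by
  rw [funext (theta_eq_jacobiTheta₂ hp0)]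
  refine Differentiable.mul (by fun_prop) ?_
  intro x
  exact (differentiableAt_jacobiTheta₂_fst _ (im_nome_pos hp0 hp1)).comp x (by fun_prop)

theorem continuous_theta {p : ℝ} (hp0 : 0 < p) (hp1 : p < 1) : Continuous (theta p) :=
  (differentiable_theta hp0 hp1).continuous

theorem dense_theta_ne_zero {p : ℝ} (hp0 : 0 < p) (hp1 : p < 1) {z : ℂ} (hz : theta p z ≠ 0) :
    Dense {w | theta p w ≠ 0} := by
  have han : AnalyticOnNhd ℂ (theta p) Set.univ :=
    (differentiable_theta hp0 hp1).differentiableOn.analyticOnNhd isOpen_univ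
  intro w
  rw [mem_closure_iff_frequently]
  intro hw
  have h0 : ∀ᶠ y in 𝓝 w, theta p y = 0 := hw.mono fun y hy => not_not.1 hy
  exact hz (han.eqOn_zero_of_preconnected_of_eventuallyEq_zero isPreconnected_univ
    (Set.mem_univ w) h0 (Set.mem_univ z))

theorem summable_theta {p : ℝ} (hp0 : 0 < p) (hp1 : p < 1) (x : ℂ) :
    Summable fun n : ℤ => ‖-(Complex.I / 2) * (-1) ^ n *
      Complex.exp ((Real.log p : ℂ) * ((n : ℂ) + 1 / 2) ^ 2 - (2 * n + 1) * x)‖ := by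
  simp_rw [thetaSeriesTerm_eq]
  exact (((summable_jacobiTheta₂_term_iff _ _).2 (im_nome_pos hp0 hp1)).mul_left _).norm

/-- With `a = m + n + 1` and `b = m - n`, the product of the terms of index `m` and `n` in the series
of `[x + y]` and `[x - y]` separates into a function of `a, x` and a function of `b, y`, because
`(m + 1/2)² + (n + 1/2)² = (a² + b²) / 2`. The indices `a` and `b` have opposite parity. -/
theorem thetaSeriesTerm_mul (p : ℝ) (x y : ℂ) (m n : ℤ) :
    (-(Complex.I / 2) * (-1) ^ m *
      Complex.exp ((Real.log p : ℂ) * ((m : ℂ) + 1 / 2) ^ 2 - (2 * m + 1) * (x + y))) *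
    (-(Complex.I / 2) * (-1) ^ n *
      Complex.exp ((Real.log p : ℂ) * ((n : ℂ) + 1 / 2) ^ 2 - (2 * n + 1) * (x - y))) =
    1 / 8 * ((-1) ^ (m + n + 1) * thetaTerm p (m + n + 1) x * thetaTerm p (m - n) y -
      thetaTerm p (m + n + 1) x * ((-1) ^ (m - n) * thetaTerm p (m - n) y)) := by
  have h1 : ∀ k : ℤ, (-1 : ℂ) ^ (-k) = (-1) ^ k := fun k => by
    rw [zpow_neg, ← inv_zpow]; norm_num
  have h2 : (-1 : ℂ) ^ (m - n) = (-1) ^ m * (-1) ^ n := by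
    rw [sub_eq_add_neg, zpow_add₀ (by norm_num), h1]
  have h3 : (-1 : ℂ) ^ (m + n + 1) = -((-1) ^ m * (-1) ^ n) := by
    rw [zpow_add₀ (by norm_num), zpow_add₀ (by norm_num), zpow_one, mul_neg_one]
  have h4 : thetaTerm p (m + n + 1) x * thetaTerm p (m - n) y =
      Complex.exp ((Real.log p : ℂ) * ((m : ℂ) + 1 / 2) ^ 2 - (2 * m + 1) * (x + y)) *
      Complex.exp ((Real.log p : ℂ) * ((n : ℂ) + 1 / 2) ^ 2 - (2 * n + 1) * (x - y)) := by
    unfold thetaTerm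
    rw [← Complex.exp_add, ← Complex.exp_add]
    congr 1
    push_cast
    ring
  rw [h2, h3]
  generalize (-1 : ℂ) ^ m = u at *
  generalize (-1 : ℂ) ^ n = v at *
  generalize Complex.exp ((Real.log p : ℂ) * ((m : ℂ) + 1 / 2) ^ 2 - (2 * m + 1) * (x + y)) = e at *
  generalize Complex.exp ((Real.log p : ℂ) * ((n : ℂ) + 1 / 2) ^ 2 - (2 * n + 1) * (x - y)) = e' at *
  linear_combination (1 / 4 * u * v) * h4 + (1 / 4 * u * v * e * e') * Complex.I_sq

theorem neg_one_zpow_eq_of_even_add {a b : ℤ} (h : Even (a + b)) : (-1 : ℂ) ^ a = (-1) ^ b := by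
  have h' : Even (a - b) := by
    rw [Int.even_sub]; rwa [Int.even_add] at h
  have := h'.neg_one_zpow (α := ℂ)
  rw [zpow_sub₀ (by norm_num)] at this
  exact (div_eq_one_iff_eq (zpow_ne_zero _ (by norm_num))).1 this

/-- The terms with `a`, `b` of equal parity cancel, and the other pairs are exactly those of the form
`(m + n + 1, m - n)`. -/
theorem tsum_thetaTerm_pair (p : ℝ) (x y : ℂ) :
    ∑' q : ℤ × ℤ, ((-1) ^ q.1 * thetaTerm p q.1 x * thetaTerm p q.2 y -
        thetaTerm p q.1 x * ((-1) ^ q.2 * thetaTerm p q.2 y)) =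
      ∑' q : ℤ × ℤ, ((-1) ^ (q.1 + q.2 + 1) * thetaTerm p (q.1 + q.2 + 1) x *
          thetaTerm p (q.1 - q.2) y -
        thetaTerm p (q.1 + q.2 + 1) x * ((-1) ^ (q.1 - q.2) * thetaTerm p (q.1 - q.2) y)) := by
  have hφ : Function.Injective fun q : ℤ × ℤ => (q.1 + q.2 + 1, q.1 - q.2) := by
    rintro ⟨a, b⟩ ⟨c, d⟩ h
    simp only [Prod.mk.injEq] at h ⊢
    omega
  refine (hφ.tsum_eq (f := fun q : ℤ × ℤ => (-1) ^ q.1 * thetaTerm p q.1 x * thetaTerm p q.2 y -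
        thetaTerm p q.1 x * ((-1) ^ q.2 * thetaTerm p q.2 y)) ?_).symm
  rintro ⟨a, b⟩ hab
  rcases Int.even_or_odd (a + b) with h | ⟨k, hk⟩
  · refine absurd ?_ hab
    dsimp only
    rw [neg_one_zpow_eq_of_even_add h]
    ring
  · refine ⟨(k, k - b), ?_⟩
    simp only [Prod.mk.injEq]
    omega

theorem theta_add_mul_theta_sub {p : ℝ} (hp0 : 0 < p) (hp1 : p < 1) (x y : ℂ) :
    theta p (x + y) * theta p (x - y) = 1 / 8 *
      ((∑' a : ℤ, (-1) ^ a * thetaTerm p a x) * (∑' a : ℤ, thetaTerm p a y) -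
        (∑' a : ℤ, thetaTerm p a x) * (∑' a : ℤ, (-1) ^ a * thetaTerm p a y)) := by
  have hg := summable_thetaTerm hp0 hp1
  have hs : ∀ x, Summable fun a : ℤ => ‖(-1) ^ a * thetaTerm p a x‖ := fun x => by
    simpa only [norm_mul, norm_zpow, norm_neg, norm_one, one_zpow, one_mul] using hg x
  have h1 := tsum_mul_tsum_of_summable_norm (R := ℂ) (f := fun a : ℤ => (-1) ^ a * thetaTerm p a x)
    (g := fun a : ℤ => thetaTerm p a y) (hs x) (hg y)
  have h2 := tsum_mul_tsum_of_summable_norm (R := ℂ) (f := fun a : ℤ => thetaTerm p a x)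
    (g := fun a : ℤ => (-1) ^ a * thetaTerm p a y) (hg x) (hs y)
  have h3 := Summable.tsum_sub
    (summable_mul_of_summable_norm (R := ℂ) (f := fun a : ℤ => (-1) ^ a * thetaTerm p a x)
      (g := fun a : ℤ => thetaTerm p a y) (hs x) (hg y))
    (summable_mul_of_summable_norm (R := ℂ) (f := fun a : ℤ => thetaTerm p a x)
      (g := fun a : ℤ => (-1) ^ a * thetaTerm p a y) (hg x) (hs y))
  have h4 := tsum_mul_tsum_of_summable_norm (R := ℂ) (summable_theta hp0 hp1 (x + y))
    (summable_theta hp0 hp1 (x - y))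
  rw [h1, h2, ← h3, tsum_thetaTerm_pair, ← tsum_mul_left, theta_eq_tsum hp0, theta_eq_tsum hp0, h4]
  exact tsum_congr fun q => thetaSeriesTerm_mul p x y q.1 q.2

/-- The three-term relation: a Plücker relation for the form `f x * g y - g x * f y` of the products
`[x + y] [x - y]`. It is parametrized so that no halves occur in the arguments. -/
theorem theta_three_term {p : ℝ} (hp0 : 0 < p) (hp1 : p < 1) (a b c d : ℂ) :
    theta p a * theta p b * theta p (c + d - a - b) * theta p (c - d) -
      theta p c * theta p (a + b - c) * theta p (d - b) * theta p (a - d) +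
      theta p d * theta p (a + b - d) * theta p (c - b) * theta p (a - c) = 0 := by
  obtain ⟨f, g, h⟩ : ∃ f g : ℂ → ℂ, ∀ x y, theta p (x + y) * theta p (x - y) =
      f x * g y - g x * f y :=
    ⟨fun x => 1 / 8 * ∑' a : ℤ, (-1) ^ a * thetaTerm p a x, fun x => ∑' a : ℤ, thetaTerm p a x,
      fun x y => by rw [theta_add_mul_theta_sub hp0 hp1]; ring⟩
  have key : ∀ x y u v : ℂ, x + y = u → x - y = v →
      theta p u * theta p v = f x * g y - g x * f y := by
    rintro x y _ _ rfl rfl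
    exact h x y
  have e1 := key ((a + b) / 2) ((a - b) / 2) a b (by ring) (by ring)
  have e2 := key (c - (a + b) / 2) (d - (a + b) / 2) (c + d - a - b) (c - d) (by ring) (by ring)
  have e3 := key ((a + b) / 2) (c - (a + b) / 2) c (a + b - c) (by ring) (by ring)
  have e4 := key ((a - b) / 2) (d - (a + b) / 2) (d - b) (a - d) (by ring) (by ring)
  have e5 := key ((a + b) / 2) (d - (a + b) / 2) d (a + b - d) (by ring) (by ring)
  have e6 := key ((a - b) / 2) (c - (a + b) / 2) (c - b) (a - c) (by ring) (by ring)
  rw [mul_assoc, e1, e2, mul_assoc, e3, e4, mul_assoc (theta p d * _), e5, e6]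
  ring

/-! ### Plaquette weights and the dynamical Yang–Baxter equation -/

/-- The three-term relation with its twelve arguments free up to linear equations, so that it can be
read off from a goal. -/
theorem theta_three_term_of {p : ℝ} (hp0 : 0 < p) (hp1 : p < 1) {a b m n c e f g d h i j : ℂ}
    (hm : m = c + d - a - b) (hn : n = c - d) (he : e = a + b - c) (hf : f = d - b) (hg : g = a - d)
    (hh : h = a + b - d) (hi : i = c - b) (hj : j = a - c) :
    theta p a * theta p b * theta p m * theta p n -
      theta p c * theta p e * theta p f * theta p g +
      theta p d * theta p h * theta p i * theta p j = 0 := by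
  subst hm hn he hf hg hh hi hj
  exact theta_three_term hp0 hp1 a b c d

/-- This relation and the next three are the Yang–Baxter equations with three terms, up to common
factors; `l` stands for `τ + (n + 1) γ` with `n` a height and `g` for `γ`. -/
theorem theta_three_term_raise {p : ℝ} (hp0 : 0 < p) (hp1 : p < 1) (l g u v : ℂ) :
    theta p (u - v + g) * theta p (v + g) * theta p (l + u) * theta p l =
    theta p (l + v) * theta p (u + g) * theta p (l + (u - v)) * theta p g +
      theta p v * theta p (l + g + u) * theta p (l - g) * theta p (u - v) := by
  have h : theta p (u - v + g) * theta p (v + g) * theta p (l + u) * theta p (-l) -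
      theta p (u + g) * theta p g * theta p (l + (u - v)) * theta p (-(l + v)) +
      theta p (l + g + u) * theta p (-(l - g)) * theta p (u - v) * theta p (-v) = 0 := by
    apply theta_three_term_of hp0 hp1 <;> ring
  simp only [theta_neg hp0] at h
  linear_combination -h

theorem theta_three_term_cross {p : ℝ} (hp0 : 0 < p) (hp1 : p < 1) (l g u v : ℂ) :
    theta p (u - v + g) * theta p (l + g + v) * theta p u * theta p l =
    theta p (u - v) * theta p (u + g) * theta p (l + v) * theta p (l + g) +
      theta p (l - (u - v)) * theta p g * theta p (l + g + u) * theta p v := by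
  have h : theta p (u - v + g) * theta p (l + g + v) * theta p u * theta p (-l) -
      theta p (u + g) * theta p (l + g) * theta p (u - v) * theta p (-(l + v)) +
      theta p (l + g + u) * theta p g * theta p (-(l - (u - v))) * theta p (-v) = 0 := by
    apply theta_three_term_of hp0 hp1 <;> ring
  simp only [theta_neg hp0] at h
  linear_combination -h

theorem theta_three_term_peak {p : ℝ} (hp0 : 0 < p) (hp1 : p < 1) (l g u v : ℂ) :
    theta p (l - (u - v)) * theta p u * theta p (v + g) * theta p (l + g) =
    theta p v * theta p (u + g) * theta p (l + g - (u - v)) * theta p l +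
      theta p (l + g + v) * theta p (l - u) * theta p g * theta p (u - v) := by
  have h : theta p (l - (u - v)) * theta p u * theta p (v + g) * theta p (-(l + g)) -
      theta p v * theta p l * theta p (l + g - (u - v)) * theta p (-(u + g)) +
      theta p (l + g + v) * theta p (-g) * theta p (-(u - v)) * theta p (l - u) = 0 := by
    apply theta_three_term_of hp0 hp1 <;> ring
  simp only [theta_neg hp0] at h
  linear_combination -h

theorem theta_three_term_valley {p : ℝ} (hp0 : 0 < p) (hp1 : p < 1) (l g u v : ℂ) :
    theta p (v + g) * theta p u * theta p (l + g + (u - v)) * theta p l =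
    theta p (u - v) * theta p (l + g + u) * theta p (l - v) * theta p g +
      theta p (l + (u - v)) * theta p (u + g) * theta p (l + g) * theta p v := by
  have h : theta p (v + g) * theta p u * theta p (l + g + (u - v)) * theta p l -
      theta p (l + g + u) * theta p (-(l - v)) * theta p g * theta p (-(u - v)) +
      theta p (u + g) * theta p v * theta p (l + g) * theta p (-(l + (u - v))) = 0 := by
    apply theta_three_term_of hp0 hp1 <;> ring
  simp only [theta_neg hp0] at h
  linear_combination h

/-- The relation behind the recursion for the coefficients of the exchange relation, see
`exchangeCoeff_castSucc`. -/
theorem theta_three_term_coeff {p : ℝ} (hp0 : 0 < p) (hp1 : p < 1) (l g u v : ℂ) :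
    theta p (l + g) * theta p (l - u) * theta p (v - u + g) * theta p v =
    theta p l * theta p (v + g) * theta p (l + g - u) * theta p (v - u) +
      theta p g * theta p (l - v) * theta p (l + g + v - u) * theta p u := by
  have h : theta p (l + g) * theta p (l - u) * theta p (v - u + g) * theta p (-v) -
      theta p (l + g - u) * theta p l * theta p (v + g) * theta p (-(v - u)) +
      theta p (l + g + v - u) * theta p (l - v) * theta p g * theta p u = 0 := by
    apply theta_three_term_of hp0 hp1 <;> ring
  simp only [theta_neg hp0] at h
  linear_combination -h

/-- The only non-trivial instance of the Yang–Baxter equation with four terms. It combines two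
three-term relations that share the factor `[2 l + g]`. -/
theorem theta_cubic_relation {p : ℝ} (hp0 : 0 < p) (hp1 : p < 1) (l g u v : ℂ) :
    theta p g ^ 3 * (theta p (l + g) * theta p (l - (u - v)) * theta p (l + g + u) *
      theta p (l - v)) + theta p (l - g) * theta p (l + g) ^ 3 * theta p (u - v) * theta p (u + g) *
      theta p v =
    theta p g ^ 3 * (theta p l * theta p (l + g + v) * theta p (l - u) *
      theta p (l + g + (u - v))) + theta p (l + g + g) * theta p l ^ 3 * theta p v *
      theta p (u + g) * theta p (u - v) := by
  have h1 : theta p (l + g + g) * theta p l * theta p (-l) * theta p l -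
      theta p (l + g) * theta p (l + g) * theta p (-(l - g)) * theta p (l + g) +
      theta p g * theta p (l + l + g) * theta p g * theta p g = 0 := by
    apply theta_three_term_of hp0 hp1 <;> ring
  have h2 : theta p (l + l + g) * theta p (u - v) * theta p v * theta p (u + g) -
      theta p (l + g + u) * theta p (l - v) * theta p (l - (u - v)) * theta p (l + g) +
      theta p l * theta p (l + g + (u - v)) * theta p (l + g + v) * theta p (l - u) = 0 := by
    apply theta_three_term_of hp0 hp1 <;> ring
  simp only [theta_neg hp0] at h1
  linear_combination theta p (u - v) * theta p v * theta p (u + g) * h1 - theta p g ^ 3 * h2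

/-- The weight of a plaquette, extended by zero to plaquettes with two neighbouring heights that do
not differ by one. -/
noncomputable def face (p : ℝ) (γ τ u : ℂ) (a b c d : ℤ) : ℂ :=
  if (a = c + 1 ∨ c = a + 1) ∧ (b = d + 1 ∨ d = b + 1) ∧ (a = b + 1 ∨ b = a + 1) ∧
    (c = d + 1 ∨ d = c + 1) then weight p γ τ u a b c d else 0

variable {p : ℝ} {γ τ : ℂ}

section Face

variable {u : ℂ} {a b c d : ℤ}

theorem face_eq_zero (h : ¬((a = c + 1 ∨ c = a + 1) ∧ (b = d + 1 ∨ d = b + 1) ∧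
    (a = b + 1 ∨ b = a + 1) ∧ (c = d + 1 ∨ d = c + 1))) : face p γ τ u a b c d = 0 :=
  if_neg h

theorem face_of_ne (h : b = c ∧ (a = c + 1 ∧ d = c - 1 ∨ a = c - 1 ∧ d = c + 1)) :
    face p γ τ u a b c d = theta p (u + γ) := by
  rw [face, if_pos (by omega), weight, if_pos (by omega)]

theorem face_peak (h : d = a ∧ b = a + 1 ∧ c = a + 1) : face p γ τ u a b c d =
    theta p (τ + ((a : ℂ) + 1) * γ - u) * theta p γ / theta p (τ + ((a : ℂ) + 1) * γ) := by
  rw [face, if_pos (by omega), weight, if_neg (by omega), if_pos (by omega)]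
  obtain ⟨-, -, rfl⟩ := h
  congr 3
  push_cast
  ring

theorem face_valley (h : d = a ∧ b = a - 1 ∧ c = a - 1) : face p γ τ u a b c d =
    theta p (τ + ((a : ℂ) + 1) * γ + u) * theta p γ / theta p (τ + ((a : ℂ) + 1) * γ) := by
  rw [face, if_pos (by omega), weight, if_neg (by omega), if_pos (by omega)]
  obtain ⟨-, -, rfl⟩ := h
  congr 3
  push_cast
  ring

theorem face_up (h : d = a ∧ b = a + 1 ∧ c = a - 1) : face p γ τ u a b c d =
    theta p (τ + ((a : ℂ) + 1) * γ + γ) * theta p u / theta p (τ + ((a : ℂ) + 1) * γ) := by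
  rw [face, if_pos (by omega), weight, if_neg (by omega), if_neg (by omega)]
  obtain ⟨-, -, rfl⟩ := h
  congr 3
  push_cast
  ring

theorem face_down (h : d = a ∧ b = a - 1 ∧ c = a + 1) : face p γ τ u a b c d =
    theta p (τ + ((a : ℂ) + 1) * γ - γ) * theta p u / theta p (τ + ((a : ℂ) + 1) * γ) := by
  rw [face, if_pos (by omega), weight, if_neg (by omega), if_neg (by omega)]
  obtain ⟨-, -, rfl⟩ := h
  congr 3
  push_cast
  ring

/-- Reversing the signs of all heights amounts to replacing `τ` by `-τ - 2 γ`. -/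
theorem face_reflect (hp0 : 0 < p) :
    face p γ (-τ - 2 * γ) u (-a) (-b) (-c) (-d) = face p γ τ u a b c d := by
  have e : -τ - 2 * γ + (((-a : ℤ) : ℂ) + 1) * γ = -(τ + ((a : ℂ) + 1) * γ) := by
    push_cast; ring
  have hadj : (-a = -c + 1 ∨ -c = -a + 1) ∧ (-b = -d + 1 ∨ -d = -b + 1) ∧
      (-a = -b + 1 ∨ -b = -a + 1) ∧ (-c = -d + 1 ∨ -d = -c + 1) ↔
      (a = c + 1 ∨ c = a + 1) ∧ (b = d + 1 ∨ d = b + 1) ∧ (a = b + 1 ∨ b = a + 1) ∧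
        (c = d + 1 ∨ d = c + 1) := by omega
  have e' : ∀ v, -(τ + ((a : ℂ) + 1) * γ) + (((-a : ℤ) : ℂ) - ((-c : ℤ) : ℂ)) * v =
      -(τ + ((a : ℂ) + 1) * γ + ((a : ℂ) - c) * v) := fun v => by push_cast; ring
  unfold face weight
  simp only [hadj, e, e', theta_neg hp0, neg_inj, ne_eq, neg_mul, neg_div_neg_eq]

end Face

/-- The two heights that may neighbour the height `n`. -/
def nbhd (n : ℤ) : Finset ℤ := {n + 1, n - 1}

theorem mem_nbhd {m n : ℤ} : m ∈ nbhd n ↔ m = n + 1 ∨ m = n - 1 := by simp [nbhd]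

theorem sum_nbhd (n : ℤ) (f : ℤ → ℂ) : ∑ m ∈ nbhd n, f m = f (n + 1) + f (n - 1) := by
  rw [nbhd, Finset.sum_pair (by omega)]

/-- The Yang–Baxter equation when the lower right height is one more than the lower left one. The
other admissible case is its mirror image. -/
theorem yangBaxter_of_succ (hp0 : 0 < p) (hp1 : p < 1)
    (hτ : ∀ k : ℤ, theta p (τ + k * γ) ≠ 0) (u v : ℂ) (n l₁ l₂ r₁ r₂ : ℤ)
    (hl : l₁ = n + 1 ∨ l₁ = n - 1) (hl' : l₂ = l₁ + 1 ∨ l₂ = l₁ - 1)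
    (hr : r₁ = n + 1 + 1 ∨ r₁ = n + 1 - 1) (hr' : r₂ = r₁ + 1 ∨ r₂ = r₁ - 1)
    (h₂ : r₂ = l₂ + 1 ∨ r₂ = l₂ - 1) :
    ∑ k ∈ nbhd n, face p γ τ (u - v) l₂ k l₁ n * face p γ τ u k r₁ n (n + 1) *
        face p γ τ v l₂ r₂ k r₁ =
      ∑ k ∈ nbhd (n + 1), face p γ τ v l₁ k n (n + 1) * face p γ τ u l₂ r₂ l₁ k *
        face p γ τ (u - v) r₂ r₁ k (n + 1) := by
  -- `[l]` is the denominator of the plaquettes whose equal diagonal heights are `n`.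
  obtain ⟨l, rfl⟩ : ∃ l, τ = l - (n + 1) * γ := ⟨τ + (n + 1) * γ, by ring⟩
  have hl0 : theta p l ≠ 0 := by
    have := hτ (n + 1); push_cast at this; convert this using 2; ring
  have hl1 : theta p (l + γ) ≠ 0 := by
    have := hτ (n + 2); push_cast at this; convert this using 2; ring
  have hl2 : theta p (l + γ + γ) ≠ 0 := by
    have := hτ (n + 3); push_cast at this; convert this using 2; ring
  have e0 : l - ((n : ℂ) + 1) * γ + ((n : ℂ) + 1) * γ = l := by ring
  have e1 : l - ((n : ℂ) + 1) * γ + ((n : ℂ) + 1 + 1) * γ = l + γ := by ring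
  have e2 : l - ((n : ℂ) + 1) * γ + ((n : ℂ) + 1 + 1 + 1) * γ = l + γ + γ := by ring
  rw [sum_nbhd, sum_nbhd]
  rcases hl with rfl | rfl <;> rcases hl' with rfl | rfl <;> rcases hr with rfl | rfl <;>
    rcases hr' with rfl | rfl <;> first | (exfalso; omega) | skip
  all_goals
    simp (disch := omega) only [face_eq_zero, face_of_ne, face_peak, face_valley, face_up, face_down,
      zero_mul, mul_zero, add_zero, zero_add]
    try simp only [add_sub_cancel_right, sub_add_cancel, Int.cast_add, Int.cast_one, e0, e1, e2]
    clear e0 e1 e2 hτ h₂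
  · ring
  · field_simp
    linear_combination theta p γ * theta_three_term_cross hp0 hp1 (l + γ) γ u v
  · have h := theta_three_term_raise hp0 hp1 (l + γ) γ u v
    rw [add_sub_cancel_right] at h
    field_simp
    linear_combination theta p γ * h
  · field_simp
    linear_combination theta p γ * theta_three_term_peak hp0 hp1 l γ u v
  · field_simp
    linear_combination theta_cubic_relation hp0 hp1 l γ u v
  · field_simp
    linear_combination -theta p γ * theta p (l - γ) * theta_three_term_cross hp0 hp1 l γ u v
  · field_simp
  · field_simp
    linear_combination -theta p γ * theta_three_term_valley hp0 hp1 l γ u v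
  · field_simp
    linear_combination -theta p γ * theta_three_term_raise hp0 hp1 l γ u v
  · ring

/-- The dynamical Yang–Baxter (star-triangle) equation. The left heights `l₀, l₁, l₂` and the right
heights `r₀, r₁, r₂` are read upwards along the boundary of a hexagon, and `k` is the height in its
interior. -/
theorem yangBaxter (hp0 : 0 < p) (hp1 : p < 1) (hτ : ∀ k : ℤ, theta p (τ + k * γ) ≠ 0) (u v : ℂ)
    (l₀ l₁ l₂ r₀ r₁ r₂ : ℤ) :
    ∑ k ∈ nbhd l₀, face p γ τ (u - v) l₂ k l₁ l₀ * face p γ τ u k r₁ l₀ r₀ *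
        face p γ τ v l₂ r₂ k r₁ =
      ∑ k ∈ nbhd r₀, face p γ τ v l₁ k l₀ r₀ * face p γ τ u l₂ r₂ l₁ k *
        face p γ τ (u - v) r₂ r₁ k r₀ := by
  by_cases h : (l₁ = l₀ + 1 ∨ l₁ = l₀ - 1) ∧ (l₂ = l₁ + 1 ∨ l₂ = l₁ - 1) ∧
      (r₁ = r₀ + 1 ∨ r₁ = r₀ - 1) ∧ (r₂ = r₁ + 1 ∨ r₂ = r₁ - 1) ∧ (r₂ = l₂ + 1 ∨ r₂ = l₂ - 1) ∧
      (r₀ = l₀ + 1 ∨ r₀ = l₀ - 1)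
  · obtain ⟨hl, hl', hr, hr', h₂, h | h⟩ := h
    -- The two values of `r₀` are exchanged by the reflection of heights.
    · subst h
      exact yangBaxter_of_succ hp0 hp1 hτ u v l₀ l₁ l₂ r₁ r₂ hl hl' hr hr' h₂
    · have hτ' : ∀ k : ℤ, theta p (-τ - 2 * γ + k * γ) ≠ 0 := fun k => by
        have := hτ (2 - k)
        rw [← neg_ne_zero, ← theta_neg hp0] at this
        convert this using 2
        push_cast
        ring
      have key := yangBaxter_of_succ hp0 hp1 hτ' u v (-l₀) (-l₁) (-l₂) (-r₁) (-r₂) (by omega) (by omega)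
        (by omega) (by omega) (by omega)
      have e : -l₀ + 1 = -r₀ := by omega
      have hn : ∀ n, nbhd (-n) = (nbhd n).map (Equiv.neg ℤ).toEmbedding := fun n => by
        ext m; simp only [mem_nbhd, Finset.mem_map_equiv, Equiv.neg_symm, Equiv.neg_apply]; omega
      rw [e, hn, hn, Finset.sum_map, Finset.sum_map] at key
      simpa only [Equiv.coe_toEmbedding, Equiv.neg_apply, face_reflect hp0] using key
  -- If some pair of outer heights is not adjacent, every term on both sides vanishes.
  · have key : ∀ x y z : ℂ, ∀ P Q R : Prop, (¬P → x = 0) → (¬Q → y = 0) → (¬R → z = 0) →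
        ¬(P ∧ Q ∧ R) → x * y * z = 0 := by
      intro x y z P Q R hx hy hz hn
      rw [mul_eq_zero, mul_eq_zero]
      tauto
    rw [Finset.sum_eq_zero, Finset.sum_eq_zero]
    · intro k hk
      refine key _ _ _ _ _ _ face_eq_zero face_eq_zero face_eq_zero ?_
      omega
    · intro k hk
      refine key _ _ _ _ _ _ face_eq_zero face_eq_zero face_eq_zero ?_
      omega

/-! ### Row operators -/

/-- The operator adding a row of spectral parameter `x` on top of the profile of heights `h`, with `a`
and `b` the new heights at the left and right ends: the sum of `f t` over the new profiles `t` from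
`a` to `b`, weighted by the plaquettes between `h` and `t`. Operators compose from the bottom
upwards: `f` stands for everything above the row. The recursion removes the leftmost column. For
`L ≥ 1` the plaquette weights force `a` to be adjacent to `h 0`; for `L = 0` no such condition is
imposed. -/
noncomputable def row (p : ℝ) (γ τ : ℂ) : (L : ℕ) → (Fin L → ℂ) → ℂ → ℤ → ℤ →
    ((Fin (L + 1) → ℤ) → ℂ) → (Fin (L + 1) → ℤ) → ℂ
  | 0, _, _, a, b, f, _ => if a = b then f fun _ => a else 0
  | L + 1, μ, x, a, b, f, h => ∑ k ∈ nbhd (h 1), face p γ τ (x - μ 0) a k (h 0) (h 1) *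
      row p γ τ L (Fin.tail μ) x k b (fun t => f (Fin.cons a t)) (Fin.tail h)

theorem row_zero (μ : Fin 0 → ℂ) (x : ℂ) (a b : ℤ) (f : (Fin 1 → ℤ) → ℂ) (h : Fin 1 → ℤ) :
    row p γ τ 0 μ x a b f h = if a = b then f fun _ => a else 0 := rfl

theorem row_succ {L : ℕ} (μ : Fin (L + 1) → ℂ) (x : ℂ) (a b : ℤ) (f : (Fin (L + 2) → ℤ) → ℂ)
    (h : Fin (L + 2) → ℤ) :
    row p γ τ (L + 1) μ x a b f h = ∑ k ∈ nbhd (h 1), face p γ τ (x - μ 0) a k (h 0) (h 1) *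
      row p γ τ L (Fin.tail μ) x k b (fun t => f (Fin.cons a t)) (Fin.tail h) := rfl

/-- Only the profiles with the prescribed end points matter. -/
theorem row_congr {L : ℕ} (μ : Fin L → ℂ) (x : ℂ) (a b : ℤ) {f g : (Fin (L + 1) → ℤ) → ℂ}
    (h : Fin (L + 1) → ℤ) (hfg : ∀ t, t 0 = a → t (Fin.last L) = b → f t = g t) :
    row p γ τ L μ x a b f h = row p γ τ L μ x a b g h := by
  induction L generalizing a with
  | zero =>
    rw [row_zero, row_zero]
    split_ifs with hab
    · exact hfg _ rfl hab
    · rfl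
  | succ L ih =>
    rw [row_succ, row_succ]
    refine Finset.sum_congr rfl fun k _ => ?_
    congr 1
    exact ih _ _ _ fun t _ ht => hfg _ rfl (by simpa [← Fin.succ_last] using ht)

theorem row_add {L : ℕ} (μ : Fin L → ℂ) (x : ℂ) (a b : ℤ) (f g : (Fin (L + 1) → ℤ) → ℂ)
    (h : Fin (L + 1) → ℤ) :
    row p γ τ L μ x a b (fun t => f t + g t) h =
      row p γ τ L μ x a b f h + row p γ τ L μ x a b g h := by
  induction L generalizing a with
  | zero => simp only [row_zero]; split_ifs <;> simp
  | succ L ih => simp only [row_succ, ih, mul_add, Finset.sum_add_distrib]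

theorem row_const_mul {L : ℕ} (μ : Fin L → ℂ) (x : ℂ) (a b : ℤ) (c : ℂ)
    (f : (Fin (L + 1) → ℤ) → ℂ) (h : Fin (L + 1) → ℤ) :
    row p γ τ L μ x a b (fun t => c * f t) h = c * row p γ τ L μ x a b f h := by
  induction L generalizing a with
  | zero => simp only [row_zero]; split_ifs <;> simp
  | succ L ih =>
    simp only [row_succ, ih, Finset.mul_sum]
    exact Finset.sum_congr rfl fun k _ => by ring

theorem row_sum {L : ℕ} (μ : Fin L → ℂ) (x : ℂ) (a b : ℤ) {ι : Type*} (s : Finset ι)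
    (f : ι → (Fin (L + 1) → ℤ) → ℂ) (h : Fin (L + 1) → ℤ) :
    row p γ τ L μ x a b (fun t => ∑ i ∈ s, f i t) h = ∑ i ∈ s, row p γ τ L μ x a b (f i) h := by
  classical
  induction s using Finset.induction_on with
  | empty => simpa using row_const_mul (p := p) (γ := γ) (τ := τ) μ x a b 0 (fun _ => 0) h
  | insert i s hi ih => simp only [Finset.sum_insert hi, row_add, ih]

/-- The possible heights two steps away from `n`. -/
def nbhdTwo (n : ℤ) : Finset ℤ := {n + 2, n, n - 2}

theorem sum_nbhd_eq_sum_nbhdTwo {n k : ℤ} (hk : k ∈ nbhd n) (f : ℤ → ℂ)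
    (hf : ∀ m, m ∉ nbhd k → f m = 0) : ∑ m ∈ nbhd k, f m = ∑ m ∈ nbhdTwo n, f m := by
  refine Finset.sum_subset (fun m hm => ?_) fun m _ => hf m
  rw [mem_nbhd] at hk hm
  simp only [nbhdTwo, Finset.mem_insert, Finset.mem_singleton]
  omega

/-- Two rows, with the leftmost column split off. The range `nbhdTwo (h 1)` of the upper height `m`
does not depend on the middle height `k`, so that the two sums can be interchanged. -/
theorem row_row_succ {L : ℕ} (μ : Fin (L + 1) → ℂ) (x y : ℂ) (l₁ l₂ r₁ r₂ : ℤ)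
    (f : (Fin (L + 2) → ℤ) → ℂ) (h : Fin (L + 2) → ℤ) :
    row p γ τ (L + 1) μ x l₁ r₁ (row p γ τ (L + 1) μ y l₂ r₂ f) h =
      ∑ k ∈ nbhd (h 1), ∑ m ∈ nbhdTwo (h 1), face p γ τ (x - μ 0) l₁ k (h 0) (h 1) *
        face p γ τ (y - μ 0) l₂ m l₁ k * row p γ τ L (Fin.tail μ) x k r₁
          (row p γ τ L (Fin.tail μ) y m r₂ fun t => f (Fin.cons l₂ t)) (Fin.tail h) := by
  rw [row_succ]
  refine Finset.sum_congr rfl fun k hk => ?_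
  rw [row_congr (g := fun t => ∑ m ∈ nbhdTwo (h 1), face p γ τ (y - μ 0) l₂ m l₁ k *
    row p γ τ L (Fin.tail μ) y m r₂ (fun t => f (Fin.cons l₂ t)) t), row_sum, Finset.mul_sum]
  · simp only [row_const_mul, mul_assoc]
  · intro t ht _
    rw [row_succ]
    simp only [Fin.cons_zero, Fin.cons_one, Fin.tail_cons, ht]
    refine sum_nbhd_eq_sum_nbhdTwo hk _ fun m hm => ?_
    rw [mem_nbhd] at hm
    rw [face_eq_zero (by omega), zero_mul]

theorem sum_sum_sum_reverse (s t u : Finset ℤ) (f : ℤ → ℤ → ℤ → ℂ) :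
    ∑ i ∈ s, ∑ j ∈ t, ∑ k ∈ u, f i j k = ∑ k ∈ u, ∑ j ∈ t, ∑ i ∈ s, f i j k :=
  (Finset.sum_congr rfl fun _ _ => Finset.sum_comm).trans
    (Finset.sum_comm.trans (Finset.sum_congr rfl fun _ _ => Finset.sum_comm))

/-- A crossing of two rows may be moved from the left boundary to the right one. -/
theorem row_yangBaxter (hp0 : 0 < p) (hp1 : p < 1) (hτ : ∀ k : ℤ, theta p (τ + k * γ) ≠ 0) {L : ℕ}
    (μ : Fin L → ℂ) (x y : ℂ) (l₁ l₂ r₁ r₂ : ℤ) (f : (Fin (L + 1) → ℤ) → ℂ)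
    (h : Fin (L + 1) → ℤ) :
    ∑ k ∈ nbhd (h 0), face p γ τ (x - y) l₂ k l₁ (h 0) *
        row p γ τ L μ x k r₁ (row p γ τ L μ y l₂ r₂ f) h =
      ∑ k ∈ nbhd (h (Fin.last L)), row p γ τ L μ y l₁ k (row p γ τ L μ x l₂ r₂ f) h *
        face p γ τ (x - y) r₂ r₁ k (h (Fin.last L)) := by
  induction L generalizing l₁ l₂ with
  | zero =>
    simp only [row_zero, Fin.last_zero]
    by_cases hl : l₂ = r₂
    · subst hl
      simp only [if_true, mul_ite, ite_mul, zero_mul, mul_zero, Finset.sum_ite_eq,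
        Finset.sum_ite_eq']
      rw [mul_comm]
      split_ifs with h1 h2 h2
      · rfl
      · rw [mem_nbhd] at h2
        rw [face_eq_zero (by omega), mul_zero]
      · rw [mem_nbhd] at h1
        rw [face_eq_zero (by omega), mul_zero]
      · rfl
    · simp [hl]
  | succ L ih =>
    set F : (Fin (L + 1) → ℤ) → ℂ := fun t => f (Fin.cons l₂ t)
    set R := row p γ τ L (Fin.tail μ)
    have hlast : h (Fin.last (L + 1)) = Fin.tail h (Fin.last L) := rfl
    have h1 : h 1 = Fin.tail h 0 := rfl
    have hyb := yangBaxter (γ := γ) hp0 hp1 hτ (x - μ 0) (y - μ 0) (h 0) l₁ l₂ (h 1)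
    simp only [sub_sub_sub_cancel_right] at hyb
    calc _ = ∑ m ∈ nbhdTwo (h 1), ∑ j ∈ nbhd (h 1), (∑ k ∈ nbhd (h 0),
          face p γ τ (x - y) l₂ k l₁ (h 0) * face p γ τ (x - μ 0) k j (h 0) (h 1) *
            face p γ τ (y - μ 0) l₂ m k j) * R x j r₁ (R y m r₂ F) (Fin.tail h) := by
          simp only [row_row_succ, Finset.mul_sum, Finset.sum_mul]
          rw [sum_sum_sum_reverse]
          simp only [mul_assoc, F, R]
      _ = ∑ m ∈ nbhdTwo (h 1), ∑ k ∈ nbhd (h 1), face p γ τ (y - μ 0) l₁ k (h 0) (h 1) *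
            face p γ τ (x - μ 0) l₂ m l₁ k * ∑ j ∈ nbhd (h 1), face p γ τ (x - y) m j k (h 1) *
              R x j r₁ (R y m r₂ F) (Fin.tail h) := by
          refine Finset.sum_congr rfl fun m _ => ?_
          simp only [hyb, Finset.sum_mul, Finset.mul_sum]
          rw [Finset.sum_comm]
          simp only [mul_assoc]
      _ = ∑ m ∈ nbhdTwo (h 1), ∑ k ∈ nbhd (h 1), face p γ τ (y - μ 0) l₁ k (h 0) (h 1) *
            face p γ τ (x - μ 0) l₂ m l₁ k * ∑ j ∈ nbhd (h (Fin.last (L + 1))),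
              R y k j (R x m r₂ F) (Fin.tail h) *
                face p γ τ (x - y) r₂ r₁ j (h (Fin.last (L + 1))) := by
          refine Finset.sum_congr rfl fun m _ => Finset.sum_congr rfl fun k _ => ?_
          rw [h1, ih, hlast]
      _ = _ := by
          simp only [row_row_succ, Finset.mul_sum, Finset.sum_mul]
          rw [sum_sum_sum_reverse]
          simp only [mul_assoc, F, R]

/-! ### The operators `A` and `B` and their exchange relations -/

/-- The operator `B x`: a row along which the left height drops and the right height rises. -/
noncomputable def rowB (p : ℝ) (γ τ : ℂ) {L : ℕ} (μ : Fin L → ℂ) (x : ℂ)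
    (f : (Fin (L + 1) → ℤ) → ℂ) (h : Fin (L + 1) → ℤ) : ℂ :=
  row p γ τ L μ x (h 0 - 1) (h (Fin.last L) + 1) f h

/-- The operator `A x`: a row along which both end heights rise. -/
noncomputable def rowA (p : ℝ) (γ τ : ℂ) {L : ℕ} (μ : Fin L → ℂ) (x : ℂ)
    (f : (Fin (L + 1) → ℤ) → ℂ) (h : Fin (L + 1) → ℤ) : ℂ :=
  row p γ τ L μ x (h 0 + 1) (h (Fin.last L) + 1) f h

theorem continuous_face (hp0 : 0 < p) (hp1 : p < 1) (a b c d : ℤ) :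
    Continuous fun u => face p γ τ u a b c d := by
  have := continuous_theta hp0 hp1
  unfold face weight
  split_ifs <;> fun_prop

theorem continuous_row (hp0 : 0 < p) (hp1 : p < 1) {L : ℕ} (μ : Fin L → ℂ) (a b : ℤ)
    {x : ℂ → ℂ} (hx : Continuous x) {f : ℂ → (Fin (L + 1) → ℤ) → ℂ}
    (hf : ∀ t, Continuous fun z => f z t) (h : Fin (L + 1) → ℤ) :
    Continuous fun z => row p γ τ L μ (x z) a b (f z) h := by
  induction L generalizing a with
  | zero =>
    simp only [row_zero]
    split_ifs
    · exact hf _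
    · exact continuous_const
  | succ L ih =>
    simp only [row_succ]
    refine continuous_finsetSum _ fun k _ => Continuous.mul ?_ (ih _ _ (fun t => hf _) _)
    exact (continuous_face hp0 hp1 a k (h 0) (h 1)).comp (hx.sub continuous_const)

theorem continuous_rowB (hp0 : 0 < p) (hp1 : p < 1) {L : ℕ} (μ : Fin L → ℂ)
    {x : ℂ → ℂ} (hx : Continuous x) {f : ℂ → (Fin (L + 1) → ℤ) → ℂ}
    (hf : ∀ t, Continuous fun z => f z t) (h : Fin (L + 1) → ℤ) :
    Continuous fun z => rowB p γ τ μ (x z) (f z) h :=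
  continuous_row hp0 hp1 μ _ _ hx hf h

/-- The Yang–Baxter equation gives commutativity up to the factor `[x - y + γ]`; where this vanishes,
both sides agree by continuity in `x`. -/
theorem rowB_comm (hp0 : 0 < p) (hp1 : p < 1) (hτ : ∀ k : ℤ, theta p (τ + k * γ) ≠ 0) {L : ℕ}
    (μ : Fin L → ℂ) (x y : ℂ) (f : (Fin (L + 1) → ℤ) → ℂ) :
    rowB p γ τ μ x (rowB p γ τ μ y f) = rowB p γ τ μ y (rowB p γ τ μ x f) := by
  funext h
  -- `z` stands for `x - y + γ`.
  have key : ∀ z, theta p z ≠ 0 → rowB p γ τ μ (z + (y - γ)) (rowB p γ τ μ y f) h =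
      rowB p γ τ μ y (rowB p γ τ μ (z + (y - γ)) f) h := by
    intro z hz
    have hyb := row_yangBaxter hp0 hp1 hτ μ (z + (y - γ)) y (h 0 - 1) (h 0 - 1 - 1)
      (h (Fin.last L) + 1) (h (Fin.last L) + 1 + 1) f h
    simp (disch := omega) only [sum_nbhd, face_of_ne, face_eq_zero, zero_mul, mul_zero, add_zero,
      zero_add] at hyb
    rw [show z + (y - γ) - y + γ = z by ring, mul_comm (theta p z)] at hyb
    have e : ∀ x y, rowB p γ τ μ x (rowB p γ τ μ y f) h = row p γ τ L μ x (h 0 - 1)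
        (h (Fin.last L) + 1) (row p γ τ L μ y (h 0 - 1 - 1) (h (Fin.last L) + 1 + 1) f) h := by
      intro x y
      refine row_congr _ _ _ _ _ fun t h0 h1 => ?_
      rw [rowB, h0, h1]
    rw [e, e]
    exact mul_right_cancel₀ hz hyb
  have hz : theta p τ ≠ 0 := by simpa using hτ 0
  have hc : Continuous fun z => z + (y - γ) := by fun_prop
  have h1 : Continuous fun z => rowB p γ τ μ (z + (y - γ)) (rowB p γ τ μ y f) h :=
    continuous_rowB hp0 hp1 μ hc (f := fun _ => rowB p γ τ μ y f) (fun t => continuous_const) h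
  have h2 : Continuous fun z => rowB p γ τ μ y (rowB p γ τ μ (z + (y - γ)) f) h :=
    continuous_rowB hp0 hp1 μ (x := fun _ => y) continuous_const
      (fun t => continuous_rowB hp0 hp1 μ hc (f := fun _ => f) (fun t => continuous_const) t) h
  have := h1.ext_on (dense_theta_ne_zero hp0 hp1 hz) h2 key
  simpa using congrFun this (x - y + γ)

/-- The exchange relation that moves `A y` from above `B x` to below, on profiles with left height
`m`: the Yang–Baxter equation with left heights `m, m + 1, m`, where the crossing on the right is
frozen. -/
theorem rowB_rowA (hp0 : 0 < p) (hp1 : p < 1) (hτ : ∀ k : ℤ, theta p (τ + k * γ) ≠ 0) {L : ℕ}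
    (μ : Fin L → ℂ) (x y : ℂ) (f : (Fin (L + 1) → ℤ) → ℂ) (h : Fin (L + 1) → ℤ) (m : ℤ)
    (hm : h 0 = m) :
    theta p (τ + m * γ) * theta p (x - y) * rowB p γ τ μ x (rowA p γ τ μ y f) h =
      theta p (τ + (m + 1) * γ) * theta p (x - y + γ) * rowA p γ τ μ y (rowB p γ τ μ x f) h -
        theta p γ * theta p (τ + (m + 1) * γ + y - x) * rowA p γ τ μ x (rowB p γ τ μ y f) h := by
  subst hm
  have hyb := row_yangBaxter hp0 hp1 hτ μ x y (h 0 + 1) (h 0)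
    (h (Fin.last L) + 1) (h (Fin.last L) + 1 + 1) f h
  simp (disch := omega) only [sum_nbhd, face_of_ne, face_peak, face_down, face_eq_zero, mul_zero,
    add_zero] at hyb
  have e1 : rowB p γ τ μ x (rowA p γ τ μ y f) h = row p γ τ L μ x (h 0 - 1)
        (h (Fin.last L) + 1) (row p γ τ L μ y (h 0) (h (Fin.last L) + 1 + 1) f) h := by
    refine row_congr _ _ _ _ _ fun t h0 h1 => ?_
    rw [rowA, h0, h1, sub_add_cancel]
  have e2 : ∀ x y, rowA p γ τ μ x (rowB p γ τ μ y f) h = row p γ τ L μ x (h 0 + 1)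
        (h (Fin.last L) + 1) (row p γ τ L μ y (h 0) (h (Fin.last L) + 1 + 1) f) h := by
    intro x y
    refine row_congr _ _ _ _ _ fun t h0 h1 => ?_
    rw [rowB, h0, h1, add_sub_cancel_right]
  rw [← e1, ← e2, ← e2] at hyb
  have hl : theta p (τ + ((h 0 : ℂ) + 1) * γ) ≠ 0 := by
    have := hτ (h 0 + 1); push_cast at this; exact this
  rw [show τ + ((h 0 : ℂ) + 1) * γ - γ = τ + h 0 * γ by ring,
    show τ + ((h 0 : ℂ) + 1) * γ - (x - y) = τ + ((h 0 : ℂ) + 1) * γ + y - x by ring] at hyb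
  field_simp at hyb
  linear_combination hyb

/-- The product `B (x 0) ⋯ B (x (K - 1))`; the row of `x 0` is the lowest. -/
noncomputable def prodB (p : ℝ) (γ τ : ℂ) {L : ℕ} (μ : Fin L → ℂ) {K : ℕ} (x : Fin K → ℂ)
    (f : (Fin (L + 1) → ℤ) → ℂ) : (Fin (L + 1) → ℤ) → ℂ :=
  (List.ofFn x).foldr (rowB p γ τ μ) f

section ProdB

variable {L K : ℕ} (μ : Fin L → ℂ)

theorem prodB_zero (x : Fin 0 → ℂ) (f : (Fin (L + 1) → ℤ) → ℂ) : prodB p γ τ μ x f = f := by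
  simp [prodB]

theorem prodB_succ (x : Fin (K + 1) → ℂ) (f : (Fin (L + 1) → ℤ) → ℂ) :
    prodB p γ τ μ x f = rowB p γ τ μ (x 0) (prodB p γ τ μ (fun i => x i.succ) f) := by
  simp [prodB, List.ofFn_succ]

theorem prodB_castSucc (x : Fin (K + 1) → ℂ) (f : (Fin (L + 1) → ℤ) → ℂ) :
    prodB p γ τ μ x f =
      prodB p γ τ μ (fun i => x i.castSucc) (rowB p γ τ μ (x (Fin.last K)) f) := by
  simp only [prodB, List.foldr_cons, List.foldr_nil, List.ofFn_succ', List.concat_eq_append,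
    List.foldr_append]

theorem prodB_comp_perm (hp0 : 0 < p) (hp1 : p < 1) (hτ : ∀ k : ℤ, theta p (τ + k * γ) ≠ 0)
    (x : Fin K → ℂ) (σ : Equiv.Perm (Fin K)) (f : (Fin (L + 1) → ℤ) → ℂ) :
    prodB p γ τ μ (x ∘ σ) f = prodB p γ τ μ x f := by
  have : LeftCommutative (rowB p γ τ μ) := ⟨fun x y f => rowB_comm hp0 hp1 hτ μ x y f⟩
  exact (Equiv.Perm.ofFn_comp_perm σ x).foldr_eq f

/-- Rows of type `B` determine the end points of the top profile. -/
theorem prodB_congr (x : Fin K → ℂ) {f g : (Fin (L + 1) → ℤ) → ℂ} (h : Fin (L + 1) → ℤ)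
    (hfg : ∀ t, t 0 + K = h 0 → t (Fin.last L) = h (Fin.last L) + K → f t = g t) :
    prodB p γ τ μ x f h = prodB p γ τ μ x g h := by
  induction K generalizing h with
  | zero => simpa only [prodB_zero] using hfg h (by simp) (by simp)
  | succ K ih =>
    rw [prodB_succ, prodB_succ]
    refine row_congr _ _ _ _ _ fun t ht ht' => ih _ _ fun s hs hs' => hfg s ?_ ?_
    · push_cast
      omega
    · push_cast
      omega

theorem prodB_mul_sub_mul (x : Fin K → ℂ) (a b : ℂ) (f g : (Fin (L + 1) → ℤ) → ℂ)
    (h : Fin (L + 1) → ℤ) :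
    prodB p γ τ μ x (fun t => a * f t - b * g t) h =
      a * prodB p γ τ μ x f h - b * prodB p γ τ μ x g h := by
  induction K generalizing h with
  | zero => simp only [prodB_zero]
  | succ K ih =>
    simp only [prodB_succ]
    have e : ∀ t, a * prodB p γ τ μ (fun i => x i.succ) f t -
        b * prodB p γ τ μ (fun i => x i.succ) g t = a * prodB p γ τ μ (fun i => x i.succ) f t +
        -b * prodB p γ τ μ (fun i => x i.succ) g t := fun t => by ring
    rw [funext (ih _), funext e, rowB, row_add, row_const_mul, row_const_mul, rowB, rowB]
    ring

theorem prodB_snoc (x : Fin K → ℂ) (y : ℂ) (f : (Fin (L + 1) → ℤ) → ℂ) :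
    prodB p γ τ μ (Fin.snoc x y : Fin (K + 1) → ℂ) f = prodB p γ τ μ x (rowB p γ τ μ y f) := by
  simp only [prodB_castSucc, Fin.snoc_castSucc, Fin.snoc_last]

theorem prodB_update_rowB_comm (hp0 : 0 < p) (hp1 : p < 1)
    (hτ : ∀ k : ℤ, theta p (τ + k * γ) ≠ 0) (x : Fin K → ℂ) (i : Fin K) (y z : ℂ)
    (f : (Fin (L + 1) → ℤ) → ℂ) :
    prodB p γ τ μ (Function.update x i z) (rowB p γ τ μ y f) =
      prodB p γ τ μ (Function.update x i y) (rowB p γ τ μ z f) := by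
  rw [← prodB_snoc, ← prodB_snoc,
    ← prodB_comp_perm μ hp0 hp1 hτ _ (Equiv.swap i.castSucc (Fin.last K))]
  congr 1
  funext j
  refine Fin.lastCases ?_ (fun k => ?_) j
  · simp
  · by_cases hk : k = i
    · subst hk
      simp only [Function.comp_apply, Equiv.swap_apply_left, Fin.snoc_last, Fin.snoc_castSucc,
        Function.update_self]
    · rw [Function.comp_apply, Equiv.swap_apply_of_ne_of_ne (by simpa [Fin.castSucc_inj] using hk)
        (Fin.castSucc_lt_last k).ne]
      simp [hk]

/-- The coefficient of `A (x i)` when `A y` is moved from the top of a product of `B`s, with top left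
height `m`, to the bottom. -/
noncomputable def exchangeCoeff (p : ℝ) (γ τ : ℂ) {K : ℕ} (m : ℤ) (x : Fin K → ℂ) (y : ℂ)
    (i : Fin K) : ℂ :=
  (theta p γ * theta p (τ + (m + 1) * γ + y - x i)) /
      (theta p (τ + (m + 1) * γ) * theta p (x i - y)) *
    ∏ j, if j = i then 1 else theta p (x j - x i + γ) / theta p (x j - x i)

theorem exchangeCoeff_last (m : ℤ) (x : Fin (K + 1) → ℂ) (y : ℂ) :
    exchangeCoeff p γ τ m x y (Fin.last K) =
      (theta p γ * theta p (τ + (m + 1) * γ + y - x (Fin.last K))) /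
        (theta p (τ + (m + 1) * γ) * theta p (x (Fin.last K) - y)) *
      ∏ j : Fin K, theta p (x j.castSucc - x (Fin.last K) + γ) /
        theta p (x j.castSucc - x (Fin.last K)) := by
  simp [exchangeCoeff, Fin.prod_univ_castSucc, (Fin.castSucc_lt_last _).ne]

/-- A term with `A (x i)` at the bottom, where the row of `x i` is not the topmost, arises in two
ways: at the topmost row the operator `A y` either passes or exchanges its parameter. -/
theorem exchangeCoeff_castSucc (hp0 : 0 < p) (hp1 : p < 1)
    (hτ : ∀ k : ℤ, theta p (τ + k * γ) ≠ 0) (m : ℤ) (x : Fin (K + 1) → ℂ) (y : ℂ) (i : Fin K)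
    (hi : theta p (x i.castSucc - y) ≠ 0) (hl : theta p (x (Fin.last K) - y) ≠ 0)
    (hil : theta p (x (Fin.last K) - x i.castSucc) ≠ 0) :
    exchangeCoeff p γ τ m x y i.castSucc =
      theta p (x (Fin.last K) - y + γ) / theta p (x (Fin.last K) - y) *
        exchangeCoeff p γ τ (m + 1) (fun j => x j.castSucc) y i -
      (theta p γ * theta p (τ + (m + 1) * γ + y - x (Fin.last K))) /
        (theta p (τ + (m + 1) * γ) * theta p (x (Fin.last K) - y)) *
        exchangeCoeff p γ τ (m + 1) (fun j => x j.castSucc) (x (Fin.last K)) i := by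
  have h1 := hτ (m + 1)
  have h2 := hτ (m + 1 + 1)
  have h := theta_three_term_coeff hp0 hp1 (τ + (m + 1) * γ) γ (x i.castSucc - y) (x (Fin.last K) - y)
  have hn : theta p (x i.castSucc - x (Fin.last K)) = -theta p (x (Fin.last K) - x i.castSucc) := by
    rw [← theta_neg hp0, neg_sub]
  simp only [exchangeCoeff, Fin.prod_univ_castSucc, Fin.castSucc_inj,
    (Fin.castSucc_lt_last _).ne', if_false, hn]
  generalize (∏ j : Fin K, if j = i then (1 : ℂ) else
    theta p (x j.castSucc - x i.castSucc + γ) / theta p (x j.castSucc - x i.castSucc)) = P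
  push_cast at h1 h2 ⊢
  rw [show τ + ((m : ℂ) + 1) * γ + γ = τ + (m + 1 + 1) * γ by ring,
    show τ + ((m : ℂ) + 1) * γ - (x i.castSucc - y) = τ + (m + 1) * γ + y - x i.castSucc by ring,
    show x (Fin.last K) - y - (x i.castSucc - y) = x (Fin.last K) - x i.castSucc by ring,
    show τ + ((m : ℂ) + 1 + 1) * γ - (x i.castSucc - y) =
      τ + (m + 1 + 1) * γ + y - x i.castSucc by ring,
    show τ + ((m : ℂ) + 1) * γ - (x (Fin.last K) - y) = τ + (m + 1) * γ + y - x (Fin.last K) by ring,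
    show τ + ((m : ℂ) + 1 + 1) * γ + (x (Fin.last K) - y) - (x i.castSucc - y) =
      τ + (m + 1 + 1) * γ + x (Fin.last K) - x i.castSucc by ring] at h
  generalize theta p (τ + ((m : ℂ) + 1) * γ) = A at *
  generalize theta p (τ + ((m : ℂ) + 1 + 1) * γ) = B at *
  generalize theta p (τ + ((m : ℂ) + 1 + 1) * γ + y - x i.castSucc) = C at *
  generalize theta p (τ + ((m : ℂ) + 1 + 1) * γ + x (Fin.last K) - x i.castSucc) = D at *
  field_simp
  linear_combination theta p γ * P * h

/-- Moving `A y` from the top of a product of `B`s to the bottom. The topmost row is passed with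
`rowB_rowA`, the others by induction; the resulting terms are collected by commutativity of the
`B`s. -/
theorem prodB_rowA (hp0 : 0 < p) (hp1 : p < 1) (hτ : ∀ k : ℤ, theta p (τ + k * γ) ≠ 0)
    (x : Fin K → ℂ) (y : ℂ) (hx : ∀ i j, i ≠ j → theta p (x i - x j) ≠ 0)
    (hy : ∀ j, theta p (x j - y) ≠ 0) (m : ℤ) (f : (Fin (L + 1) → ℤ) → ℂ) (h : Fin (L + 1) → ℤ)
    (hm : h 0 + 1 = m + K) :
    theta p (τ + m * γ) * prodB p γ τ μ x (rowA p γ τ μ y f) h =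
      theta p (τ + (m + K) * γ) *
        ((∏ j, theta p (x j - y + γ) / theta p (x j - y)) * rowA p γ τ μ y (prodB p γ τ μ x f) h -
          ∑ i, exchangeCoeff p γ τ m x y i *
            rowA p γ τ μ (x i) (prodB p γ τ μ (Function.update x i y) f) h) := by
  induction K generalizing m y f with
  | zero => simp [prodB_zero]
  | succ K ih =>
    have hl := hy (Fin.last K)
    have hm1 : theta p (τ + (m + 1) * γ) ≠ 0 := by
      have := hτ (m + 1); push_cast at this; exact this
    set z := x (Fin.last K)
    set x' : Fin K → ℂ := fun j => x j.castSucc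
    have hx' : ∀ i j, i ≠ j → theta p (x' i - x' j) ≠ 0 := fun i j hij =>
      hx _ _ (by simpa [Fin.castSucc_inj] using hij)
    have key : theta p (τ + m * γ) * theta p (z - y) * prodB p γ τ μ x (rowA p γ τ μ y f) h =
        theta p (τ + (m + 1) * γ) * theta p (z - y + γ) *
            prodB p γ τ μ x' (rowA p γ τ μ y (rowB p γ τ μ z f)) h -
          theta p γ * theta p (τ + (m + 1) * γ + y - z) *
            prodB p γ τ μ x' (rowA p γ τ μ z (rowB p γ τ μ y f)) h := by
      rw [← prodB_mul_sub_mul, prodB_castSucc, ← sub_zero (_ * prodB p γ τ μ _ _ h),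
        ← zero_mul (prodB p γ τ μ x' f h), ← prodB_mul_sub_mul]
      refine prodB_congr _ _ _ fun t ht _ => ?_
      rw [zero_mul, sub_zero]
      exact rowB_rowA hp0 hp1 hτ μ z y f t m (by push_cast at hm; omega)
    have ih1 := ih x' y hx' (fun j => hy _) (m + 1) (rowB p γ τ μ z f) (by push_cast at hm; omega)
    have ih2 := ih x' z hx' (fun j => hx _ _ (Fin.castSucc_lt_last _).ne) (m + 1)
      (rowB p γ τ μ y f) (by push_cast at hm; omega)
    -- In the terms with `A (x i)` at the bottom, the parameters `y` and `z` of the `B`s at positions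
    -- `i` and `K` can be interchanged, so that the two sources of each such term combine.
    have hU : ∀ i, prodB p γ τ μ (Function.update x' i z) (rowB p γ τ μ y f) =
        prodB p γ τ μ (Function.update x' i y) (rowB p γ τ μ z f) := fun i =>
      prodB_update_rowB_comm μ hp0 hp1 hτ x' i y z f
    have hV : ∀ i, prodB p γ τ μ (Function.update x i.castSucc y) f =
        prodB p γ τ μ (Function.update x' i y) (rowB p γ τ μ z f) := by
      intro i
      rw [prodB_castSucc, Function.update_of_ne (Fin.castSucc_lt_last i).ne']
      congr 1
      funext j
      simp only [Function.update_apply, Fin.castSucc_inj, x']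
    have hW : prodB p γ τ μ (Function.update x (Fin.last K) y) f =
        prodB p γ τ μ x' (rowB p γ τ μ y f) := by
      rw [prodB_castSucc, Function.update_self]
      congr 1
      funext j
      rw [Function.update_of_ne (Fin.castSucc_lt_last j).ne]
    have hX : prodB p γ τ μ x f = prodB p γ τ μ x' (rowB p γ τ μ z f) := prodB_castSucc _ _ _
    have hc := fun i : Fin K => exchangeCoeff_castSucc hp0 hp1 hτ m x y i (hy _) (hy _)
      (hx _ _ (Fin.castSucc_lt_last i).ne')
    simp only [hU] at ih2
    rw [Fin.sum_univ_castSucc, Fin.prod_univ_castSucc, hW, hX, exchangeCoeff_last]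
    simp only [hV, hc, sub_mul _ _ (rowA ..), mul_assoc _ (exchangeCoeff ..),
      Finset.sum_sub_distrib, ← Finset.mul_sum]
    push_cast at ih1 ih2 ⊢
    rw [show (m : ℂ) + (K + 1) = m + 1 + K by ring]
    have hr : theta p (z - y + γ) / theta p (z - y) * theta p (z - y) = theta p (z - y + γ) :=
      div_mul_cancel₀ _ hl
    have hs : theta p γ * theta p (τ + (m + 1) * γ + y - z) /
        (theta p (τ + (m + 1) * γ) * theta p (z - y)) *
          (theta p (τ + (m + 1) * γ) * theta p (z - y)) =
        theta p γ * theta p (τ + (m + 1) * γ + y - z) :=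
      div_mul_cancel₀ _ (mul_ne_zero hm1 hl)
    apply mul_left_cancel₀ (mul_ne_zero hm1 hl)
    change _ = _ * (_ * (_ * (theta p (z - y + γ) / theta p (z - y)) * _ -
      (theta p (z - y + γ) / theta p (z - y) * _ - _ + theta p γ * theta p (τ + (m + 1) * γ + y - z) /
        (theta p (τ + (m + 1) * γ) * theta p (z - y)) * _ * _)))
    generalize theta p (z - y + γ) / theta p (z - y) = r at *
    generalize theta p γ * theta p (τ + (m + 1) * γ + y - z) /
        (theta p (τ + (m + 1) * γ) * theta p (z - y)) = s at *
    simp only [z, x'] at key ih1 ih2 hr hs ⊢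
    linear_combination theta p (τ + (m + 1) * γ) * key +
      theta p (τ + (m + 1) * γ) * theta p (x (Fin.last K) - y + γ) * ih1 -
      theta p γ * theta p (τ + (m + 1) * γ + y - x (Fin.last K)) * ih2 -
      theta p (τ + (m + 1) * γ) * theta p (τ + (m + 1 + K) * γ) *
        ((∏ j : Fin K, theta p (x j.castSucc - y + γ) / theta p (x j.castSucc - y)) *
          rowA p γ τ μ y (prodB p γ τ μ (fun j => x j.castSucc)
            (rowB p γ τ μ (x (Fin.last K)) f)) h -
          ∑ i : Fin K, exchangeCoeff p γ τ (m + 1) (fun j => x j.castSucc) y i *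
            rowA p γ τ μ (x i.castSucc) (prodB p γ τ μ
              (Function.update (fun j => x j.castSucc) i y)
                (rowB p γ τ μ (x (Fin.last K)) f)) h) * hr +
      theta p (τ + (m + 1 + K) * γ) *
        ((∏ j : Fin K, theta p (x j.castSucc - x (Fin.last K) + γ) /
            theta p (x j.castSucc - x (Fin.last K))) *
          rowA p γ τ μ (x (Fin.last K)) (prodB p γ τ μ (fun j => x j.castSucc)
            (rowB p γ τ μ y f)) h -
          ∑ i : Fin K, exchangeCoeff p γ τ (m + 1) (fun j => x j.castSucc) (x (Fin.last K)) i *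
            rowA p γ τ μ (x i.castSucc) (prodB p γ τ μ
              (Function.update (fun j => x j.castSucc) i y)
                (rowB p γ τ μ (x (Fin.last K)) f)) h) * hs

end ProdB

/-! ### The partition function as a matrix element -/

section PathSum

variable {α : Type*}

/-- The sum over the paths `s` of length `n` that start at `a` and whose `i`-th step lies in `T i`, of
`f s` weighted by the product of the weights `w i` of the steps, as an iterated sum. -/
noncomputable def pathSum : (n : ℕ) → (Fin n → α → Finset α) → (Fin n → α → α → ℂ) →
    ((Fin (n + 1) → α) → ℂ) → α → ℂ
  | 0, _, _, f, a => f fun _ => a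
  | n + 1, T, w, f, a => ∑ b ∈ T 0 a, w 0 a b *
      pathSum n (fun i => T i.succ) (fun i => w i.succ) (fun s => f (Fin.cons a s)) b

/-- An iterated sum over paths is a sum over any finite set `S` that consists of the admissible paths
subject to a condition `Q` that holds wherever `f` does not vanish. -/
theorem pathSum_eq_sum {n : ℕ} (T : Fin n → α → Finset α) (w : Fin n → α → α → ℂ)
    (f : (Fin (n + 1) → α) → ℂ) (a : α) (S : Finset (Fin (n + 1) → α))
    (Q : (Fin (n + 1) → α) → Prop) (hQ : ∀ s, ¬Q s → f s = 0)
    (hS : ∀ s, s ∈ S ↔ s 0 = a ∧ (∀ i : Fin n, s i.succ ∈ T i (s i.castSucc)) ∧ Q s) :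
    pathSum n T w f a = ∑ s ∈ S, (∏ i : Fin n, w i (s i.castSucc) (s i.succ)) * f s := by
  classical
  induction n generalizing a with
  | zero =>
    have hc : ∀ s : Fin 1 → α, s 0 = a → s = fun _ => a := fun s hs => by
      funext i; rw [Subsingleton.elim i 0, hs]
    by_cases h : Q fun _ => a
    · have : S = {fun _ => a} := by
        ext s
        rw [hS, Finset.mem_singleton]
        exact ⟨fun hs => hc s hs.1, fun hs => by subst hs; exact ⟨rfl, fun i => i.elim0, h⟩⟩
      simp [pathSum, this]
    · have : S = ∅ := by
        refine Finset.eq_empty_of_forall_notMem fun s hs => h ?_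
        rw [hS] at hs
        exact hc s hs.1 ▸ hs.2.2
      simp [pathSum, this, hQ _ h]
  | succ n ih =>
    rw [pathSum, ← Finset.sum_fiberwise_of_maps_to (t := T 0 a) (g := fun s : Fin (n + 2) → α => s 1)]
    · refine Finset.sum_congr rfl fun b hb => ?_
      -- The paths in `S` start at `a`, hence are determined by their tails.
      have hinj : Set.InjOn (Fin.tail : (Fin (n + 2) → α) → _)
          (S.filter fun s => s 1 = b : Finset (Fin (n + 2) → α)) := by
        intro s hs t ht hst
        simp only [Finset.coe_filter, Set.mem_ofPred_eq, hS] at hs ht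
        rw [← Fin.cons_self_tail s, ← Fin.cons_self_tail t, hst, hs.1.1, ht.1.1]
      rw [ih (S := (S.filter fun s => s 1 = b).image Fin.tail) (Q := fun s => Q (Fin.cons a s)),
        Finset.sum_image hinj, Finset.mul_sum]
      · refine Finset.sum_congr rfl fun s hs => ?_
        simp only [Finset.mem_filter, hS] at hs
        rw [Fin.prod_univ_succ, ← hs.1.1, Fin.cons_self_tail, ← hs.2]
        simp only [Fin.tail, Fin.castSucc_zero, Fin.succ_zero_eq_one, ← Fin.succ_castSucc]
        ring
      · exact fun s hs => hQ _ hs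
      · intro s
        simp only [Finset.mem_image, Finset.mem_filter, hS]
        constructor
        · rintro ⟨s, ⟨⟨h0, hT, hq⟩, h1⟩, rfl⟩
          refine ⟨h1, fun i => hT i.succ, ?_⟩
          rwa [← h0, Fin.cons_self_tail]
        · rintro ⟨h0, hT, hq⟩
          refine ⟨Fin.cons a s, ⟨⟨rfl, ?_, hq⟩, ?_⟩, Fin.tail_cons _ _⟩
          · refine Fin.cases ?_ fun i => ?_
            · simpa [h0] using hb
            · simpa [← Fin.succ_castSucc] using hT i
          · simpa using h0
    · intro s hs
      rw [hS] at hs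
      have := hs.2.1 0
      rw [Fin.castSucc_zero, hs.1] at this
      simpa using this

end PathSum

open Classical in
/-- The profiles that may lie above `h` in a row of type `B`. -/
noncomputable def rowSet {L : ℕ} (h : Fin (L + 1) → ℤ) : Finset (Fin (L + 1) → ℤ) :=
  (Fintype.piFinset fun j => nbhd (h j)).filter fun t => t 0 = h 0 - 1 ∧
    t (Fin.last L) = h (Fin.last L) + 1 ∧
    ∀ j : Fin L, t j.succ ∈ nbhd (t j.castSucc) ∧ h j.succ ∈ nbhd (h j.castSucc)

theorem mem_rowSet {L : ℕ} {h t : Fin (L + 1) → ℤ} : t ∈ rowSet h ↔ (∀ j, t j ∈ nbhd (h j)) ∧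
    t 0 = h 0 - 1 ∧ t (Fin.last L) = h (Fin.last L) + 1 ∧
    ∀ j : Fin L, t j.succ ∈ nbhd (t j.castSucc) ∧ h j.succ ∈ nbhd (h j.castSucc) := by
  classical
  rw [rowSet, Finset.mem_filter, Fintype.mem_piFinset]

open Classical in
theorem row_eq_pathSum {L : ℕ} (μ : Fin L → ℂ) (x : ℂ) (a b : ℤ) (f : (Fin (L + 1) → ℤ) → ℂ)
    (h : Fin (L + 1) → ℤ) :
    row p γ τ L μ x a b f h = pathSum L
      (fun j k => (nbhd (h j.succ)).filter fun k' => k ∈ nbhd (h j.castSucc) ∧ k' ∈ nbhd k ∧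
        h j.succ ∈ nbhd (h j.castSucc))
      (fun j k k' => weight p γ τ (x - μ j) k k' (h j.castSucc) (h j.succ))
      (fun t => if t (Fin.last L) = b then f t else 0) a := by
  induction L generalizing a with
  | zero => rfl
  | succ L ih =>
    rw [row_succ, pathSum, Finset.sum_filter]
    refine Finset.sum_congr rfl fun k hk => ?_
    rw [face, ite_mul, zero_mul, ih]
    simp only [Fin.succ_zero_eq_one, Fin.castSucc_zero, mem_nbhd] at hk ⊢
    refine if_congr (by omega) ?_ rfl
    rfl

theorem rowB_eq_sum {L : ℕ} (μ : Fin L → ℂ) (x : ℂ) (f : (Fin (L + 1) → ℤ) → ℂ)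
    (h : Fin (L + 1) → ℤ) :
    rowB p γ τ μ x f h = ∑ t ∈ rowSet h, (∏ j : Fin L,
      weight p γ τ (x - μ j) (t j.castSucc) (t j.succ) (h j.castSucc) (h j.succ)) * f t := by
  classical
  rw [rowB, row_eq_pathSum, pathSum_eq_sum (S := rowSet h)
    (Q := fun t => t (Fin.last L) = h (Fin.last L) + 1)]
  · refine Finset.sum_congr rfl fun t ht => ?_
    rw [if_pos (mem_rowSet.1 ht).2.2.1]
  · exact fun t ht => if_neg ht
  · intro t
    simp only [mem_rowSet, Finset.mem_filter]
    constructor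
    · rintro ⟨h1, h2, h3, h4⟩
      exact ⟨h2, fun j => ⟨h1 _, h1 _, h4 j⟩, h3⟩
    · rintro ⟨h1, h2, h3⟩
      refine ⟨Fin.cases ?_ fun j => (h2 j).1, h1, h3, fun j => (h2 j).2.2⟩
      rw [h1, mem_nbhd]
      exact Or.inr rfl

theorem prodB_eq_pathSum {L K : ℕ} (μ : Fin L → ℂ) (x : Fin K → ℂ) (f : (Fin (L + 1) → ℤ) → ℂ)
    (h : Fin (L + 1) → ℤ) :
    prodB p γ τ μ x f h = pathSum K (fun _ => rowSet)
      (fun i h t => ∏ j : Fin L,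
        weight p γ τ (x i - μ j) (t j.castSucc) (t j.succ) (h j.castSucc) (h j.succ))
      (fun s => f (s (Fin.last K))) h := by
  induction K generalizing h with
  | zero => rw [prodB_zero]; rfl
  | succ K ih =>
    rw [prodB_succ, rowB_eq_sum, pathSum]
    refine Finset.sum_congr rfl fun t _ => ?_
    rw [ih]
    rfl

/-- The indicator function of the profile `a, a + 1, …, a + L`. -/
noncomputable def ascending (L : ℕ) (a : ℤ) (t : Fin (L + 1) → ℤ) : ℂ :=
  if t = fun j : Fin (L + 1) => a + (j : ℤ) then 1 else 0

theorem isDomainWall_iff {L : ℕ} {n : Fin (L + 1) → Fin (L + 1) → ℤ} :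
    IsDomainWall L n ↔ (n 0 = fun j : Fin (L + 1) => (L : ℤ) - j) ∧
      (∀ i : Fin L, n i.succ ∈ rowSet (n i.castSucc)) ∧ n (Fin.last L) = fun j : Fin (L + 1) => 0 + (j : ℤ) := by
  have habs : ∀ a b : ℤ, |a - b| = 1 ↔ a ∈ nbhd b := fun a b => by
    rw [mem_nbhd, abs_eq (by norm_num)]; omega
  constructor
  · intro hn
    refine ⟨funext hn.first_row, fun i => mem_rowSet.2 ⟨fun j => (habs _ _).1 (hn.step_row i j),
      ?_, ?_, fun j => ⟨(habs _ _).1 (hn.step_col _ j), (habs _ _).1 (hn.step_col _ j)⟩⟩,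
      funext fun j => by rw [hn.last_row, zero_add]⟩
    · rw [hn.first_col, hn.first_col, Fin.val_succ, Fin.val_castSucc]; push_cast; ring
    · rw [hn.last_col, hn.last_col, Fin.val_succ, Fin.val_castSucc]; push_cast; ring
  · rintro ⟨h0, hs, hl⟩
    refine ⟨fun i j => (habs _ _).2 ((mem_rowSet.1 (hs i)).1 j), ?_, fun j => by rw [h0], ?_,
      fun j => by simp [hl], ?_⟩
    · intro i j
      refine Fin.lastCases ?_ (fun i => ?_) i
      · simp [hl]
      · exact (habs _ _).2 ((mem_rowSet.1 (hs i)).2.2.2 j).2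
    · intro i
      induction i using Fin.induction with
      | zero => rw [h0]
      | succ i ih =>
        rw [(mem_rowSet.1 (hs i)).2.1, ih, Fin.val_succ, Fin.val_castSucc]; push_cast; ring
    · intro i
      induction i using Fin.induction with
      | zero => rw [h0]; simp
      | succ i ih =>
        rw [(mem_rowSet.1 (hs i)).2.2.1, ih, Fin.val_succ, Fin.val_castSucc]; push_cast; ring

theorem Z_eq_prodB {L : ℕ} (x μ : Fin L → ℂ) :
    Z p γ τ x μ = prodB p γ τ μ x (ascending L 0) fun j => (L : ℤ) - j := by
  rw [prodB_eq_pathSum, pathSum_eq_sum (S := (finite_isDomainWall L).toFinset)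
    (Q := fun n => n (Fin.last L) = fun j : Fin (L + 1) => 0 + (j : ℤ)), Z]
  · refine Finset.sum_congr rfl fun n hn => ?_
    rw [Set.Finite.mem_toFinset, Set.mem_ofPred_eq, isDomainWall_iff] at hn
    rw [ascending, if_pos hn.2.2, mul_one]
  · exact fun n hn => if_neg hn
  · intro n
    rw [Set.Finite.mem_toFinset, Set.mem_ofPred_eq, isDomainWall_iff]

/-- A row that raises both ends of a descending profile is frozen. -/
theorem row_descending {L : ℕ} (μ : Fin L → ℂ) (x : ℂ) (c : ℤ) (f : (Fin (L + 1) → ℤ) → ℂ) :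
    row p γ τ L μ x (c + 1) (c - L + 1) f (fun j => c - j) =
      (∏ j, theta p (x - μ j + γ)) * f fun j => c + 1 - j := by
  induction L generalizing c with
  | zero =>
    simp only [row_zero, Finset.univ_eq_empty, Finset.prod_empty, one_mul]
    rw [if_pos (by simp)]
    congr 1
    funext j
    simp
  | succ L ih =>
    have e : (Fin.tail fun j : Fin (L + 2) => c - (j : ℤ)) = fun j : Fin (L + 1) => c - 1 - (j : ℤ) := by
      funext j; simp [Fin.tail]; ring
    have e' : (Fin.cons (c + 1) fun j : Fin (L + 1) => c - (j : ℤ) : Fin (L + 2) → ℤ) =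
        fun j : Fin (L + 2) => c + 1 - (j : ℤ) := by
      funext j
      refine Fin.cases ?_ (fun j => ?_) j
      · simp
      · simp only [Fin.cons_succ, Fin.val_succ]; push_cast; ring
    have h1 := ih (Fin.tail μ) (c - 1) (fun t => f (Fin.cons (c + 1) t))
    simp only [sub_add_cancel] at h1
    rw [e', show c - 1 - (L : ℤ) + 1 = c - ((L + 1 : ℕ) : ℤ) + 1 by push_cast; ring] at h1
    rw [row_succ, e, sum_nbhd]
    simp only [Fin.val_zero, Fin.val_one, Nat.cast_zero, Nat.cast_one, sub_zero, sub_add_cancel]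
    rw [face_of_ne (by omega), face_eq_zero (by omega), h1, Fin.prod_univ_succ]
    simp only [Fin.tail]
    ring

/-- A row that ends in the ascending profile from `a`, with left height rising, is frozen. Its weight
depends on the spectral parameter only through `∏ j, [y - μ j]`. -/
theorem row_ascending {L : ℕ} (μ : Fin L → ℂ) (a : ℤ) : ∃ G : (Fin (L + 1) → ℤ) → ℂ,
    ∀ y t, t 0 = a - 1 → row p γ τ L μ y a (a + L) (ascending L a) t =
      (∏ j, theta p (y - μ j)) * G t := by
  induction L generalizing a with
  | zero =>
    refine ⟨fun _ => 1, fun y t _ => ?_⟩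
    rw [row_zero, if_pos (by simp), ascending, if_pos (by funext j; simp)]
    simp
  | succ L ih =>
    obtain ⟨G, hG⟩ := ih (Fin.tail μ) (a + 1)
    have hcons : ∀ t : Fin (L + 1) → ℤ, ascending (L + 1) a (Fin.cons a t) = ascending L (a + 1) t := by
      intro t
      unfold ascending
      refine if_congr ?_ rfl rfl
      rw [funext_iff, funext_iff, Fin.forall_fin_succ]
      simp only [Fin.cons_zero, Fin.cons_succ, Fin.val_zero, Fin.val_succ]
      push_cast
      simp [add_comm, add_left_comm]
    refine ⟨fun t => if t 1 = a then theta p (τ + ((a : ℂ) + 1) * γ + γ) /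
      theta p (τ + ((a : ℂ) + 1) * γ) * G (Fin.tail t) else 0, fun y t ht => ?_⟩
    have hz : ∀ k, k ≠ a + 1 → row p γ τ L (Fin.tail μ) y k (a + ((L + 1 : ℕ) : ℤ))
        (ascending L (a + 1)) (Fin.tail t) = 0 := by
      intro k hk
      rw [row_congr (g := fun _ => 0 * 0), row_const_mul, zero_mul]
      intro s hs _
      rw [ascending, if_neg, zero_mul]
      rintro rfl
      simp at hs
      omega
    rw [row_succ, ht]
    simp only [hcons]
    by_cases h1 : t 1 = a
    · rw [h1, if_pos rfl, sum_nbhd, hz (a - 1) (by omega), face_up (by omega), mul_zero, add_zero,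
        show a + ((L + 1 : ℕ) : ℤ) = a + 1 + L by push_cast; ring, hG y (Fin.tail t) (by
          rw [add_sub_cancel_right]; exact h1), Fin.prod_univ_succ]
      simp only [Fin.tail]
      ring
    · rw [if_neg h1, mul_zero]
      refine Finset.sum_eq_zero fun k hk => ?_
      by_cases hka : k = a + 1
      · rw [face_eq_zero (by rw [mem_nbhd] at hk; omega), zero_mul]
      · rw [hz k hka, mul_zero]

/-! ### The functional equation -/

theorem prodB_const_mul {L K : ℕ} (μ : Fin L → ℂ) (x : Fin K → ℂ) (a : ℂ)
    (f : (Fin (L + 1) → ℤ) → ℂ) (h : Fin (L + 1) → ℤ) :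
    prodB p γ τ μ x (fun t => a * f t) h = a * prodB p γ τ μ x f h := by
  simpa using prodB_mul_sub_mul (p := p) (γ := γ) (τ := τ) μ x a 0 f f h

theorem rowA_prodB_eq {L : ℕ} (x μ : Fin L → ℂ) (y : ℂ) :
    rowA p γ τ μ y (prodB p γ τ μ x (ascending L 0)) (fun j => (L : ℤ) - 1 - j) =
      (∏ j, theta p (y - μ j + γ)) * Z p γ τ x μ := by
  have h := row_descending (p := p) (γ := γ) (τ := τ) μ y ((L : ℤ) - 1)
    (prodB p γ τ μ x (ascending L 0))
  simp only [sub_add_cancel] at h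
  rw [Z_eq_prodB, ← h, rowA]
  congr 1
  simp

/-- The sum attached to the additional variable `y` does not depend on `y`: it is, up to factors free of
`y`, the matrix element with `A y` at the top. -/
theorem exists_common_value (hp0 : 0 < p) (hp1 : p < 1) (hτ : ∀ k : ℤ, theta p (τ + k * γ) ≠ 0)
    {L : ℕ} (x μ : Fin L → ℂ) (hx : ∀ i j, i ≠ j → theta p (x i - x j) ≠ 0) :
    ∃ C : ℂ, ∀ y, (∀ j, theta p (x j - y) ≠ 0) → (∀ j, theta p (y - μ j) ≠ 0) →
      (∏ j, (theta p (y - μ j + γ) * theta p (x j - y + γ)) /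
          (theta p (y - μ j) * theta p (x j - y))) * Z p γ τ x μ -
        ∑ i, coeffN p γ τ x μ y i * Z p γ τ (Function.update x i y) μ = C := by
  obtain ⟨G, hG⟩ := row_ascending (p := p) (γ := γ) (τ := τ) μ 0
  refine ⟨theta p τ * prodB p γ τ μ x G (fun j => (L : ℤ) - 1 - j) / theta p (τ + L * γ),
    fun y hy hyμ => ?_⟩
  have hL : theta p (τ + L * γ) ≠ 0 := by simpa using hτ L
  have hP : (∏ j, theta p (y - μ j)) ≠ 0 := Finset.prod_ne_zero_iff.2 fun j _ => hyμ j
  have h := prodB_rowA μ hp0 hp1 hτ x y hx hy 0 (ascending L 0) (fun j => (L : ℤ) - 1 - j)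
    (by simp)
  have hA : prodB p γ τ μ x (rowA p γ τ μ y (ascending L 0)) (fun j => (L : ℤ) - 1 - j) =
      (∏ j, theta p (y - μ j)) * prodB p γ τ μ x G (fun j => (L : ℤ) - 1 - j) := by
    rw [← prodB_const_mul]
    refine prodB_congr _ _ _ fun t h0 h1 => ?_
    simp only [Fin.val_zero, Nat.cast_zero, Fin.val_last] at h0 h1
    rw [← hG y t (by omega), rowA]
    congr 1 <;> omega
  rw [hA] at h
  simp only [rowA_prodB_eq, Int.cast_zero, zero_mul, add_zero, zero_add] at h
  have hN : ∀ i, coeffN p γ τ x μ y i * (∏ j, theta p (y - μ j)) =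
      exchangeCoeff p γ τ 0 x y i * ∏ j, theta p (x i - μ j + γ) := by
    intro i
    have e : (∏ j ∈ Finset.univ.erase i, theta p (x j - x i + γ) / theta p (x j - x i)) =
        ∏ j, if j = i then 1 else theta p (x j - x i + γ) / theta p (x j - x i) := by
      rw [← Finset.mul_prod_erase _ _ (Finset.mem_univ i), if_pos rfl, one_mul]
      exact Finset.prod_congr rfl fun j hj => (if_neg (Finset.ne_of_mem_erase hj)).symm
    rw [coeffN, exchangeCoeff, e, Finset.prod_div_distrib (f := fun j => theta p (x i - μ j + γ))]
    simp only [Int.cast_zero, zero_add, one_mul]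
    generalize theta p γ * theta p (τ + γ + y - x i) /
      (theta p (τ + γ) * theta p (x i - y)) = a
    field_simp
  rw [eq_div_iff hL]
  apply mul_left_cancel₀ hP
  have hM : (∏ j, (theta p (y - μ j + γ) * theta p (x j - y + γ)) /
        (theta p (y - μ j) * theta p (x j - y))) * (∏ j, theta p (y - μ j)) =
      (∏ j, theta p (x j - y + γ) / theta p (x j - y)) * ∏ j, theta p (y - μ j + γ) := by
    rw [← Finset.prod_mul_distrib, ← Finset.prod_mul_distrib]
    refine Finset.prod_congr rfl fun j _ => ?_
    have := hyμ j
    have := hy j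
    field_simp
  have hS : (∏ j, theta p (y - μ j)) *
      ∑ i, coeffN p γ τ x μ y i * Z p γ τ (Function.update x i y) μ =
      ∑ i, exchangeCoeff p γ τ 0 x y i * ((∏ j, theta p (x i - μ j + γ)) *
        Z p γ τ (Function.update x i y) μ) := by
    rw [Finset.mul_sum]
    refine Finset.sum_congr rfl fun i _ => ?_
    linear_combination Z p γ τ (Function.update x i y) μ * hN i
  linear_combination -h + theta p (τ + L * γ) * Z p γ τ x μ * hM - theta p (τ + L * γ) * hS

theorem coeffNbar_eq_neg_coeffN (hp0 : 0 < p) {L : ℕ} (x μ : Fin L → ℂ) (y : ℂ) (i : Fin L) :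
    coeffNbar p γ τ x μ y i = -coeffN p γ τ x μ y i := by
  rw [coeffNbar, coeffN, ← neg_sub (x i) y, theta_neg hp0, mul_neg, div_neg, neg_mul, neg_mul]

/-- The functional equation for dynamical parameters at which no weight of any height is singular. -/
theorem functional_equation_of_generic (hp0 : 0 < p) (hp1 : p < 1)
    (hτ : ∀ k : ℤ, theta p (τ + k * γ) ≠ 0)
    {L : ℕ} (x μ : Fin L → ℂ) (x₀ x₀' : ℂ)
    (hx : ∀ i j : Fin L, i ≠ j → theta p (x i - x j) ≠ 0)
    (hx₀ : ∀ j : Fin L, theta p (x j - x₀) ≠ 0)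
    (hx₀' : ∀ j : Fin L, theta p (x j - x₀') ≠ 0)
    (hμ₀ : ∀ j : Fin L, theta p (x₀ - μ j) ≠ 0)
    (hμ₀' : ∀ j : Fin L, theta p (x₀' - μ j) ≠ 0) :
    coeffM p γ x μ x₀ x₀' * Z p γ τ x μ +
      ∑ i : Fin L, coeffN p γ τ x μ x₀ i * Z p γ τ (Function.update x i x₀) μ +
      ∑ i : Fin L, coeffNbar p γ τ x μ x₀' i * Z p γ τ (Function.update x i x₀') μ = 0 := by
  obtain ⟨C, hC⟩ := exists_common_value hp0 hp1 hτ x μ hx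
  have h := hC x₀ hx₀ hμ₀
  have h' := hC x₀' hx₀' hμ₀'
  simp only [coeffNbar_eq_neg_coeffN hp0, neg_mul, Finset.sum_neg_distrib, coeffM]
  linear_combination h' - h

/-- A plaquette whose weight has a denominator has that denominator among `[τ + γ], …, [τ + L γ]`. -/
theorem IsDomainWall.bounds_of_eq {L : ℕ} {n : Fin (L + 1) → Fin (L + 1) → ℤ} (hn : IsDomainWall L n)
    (i j : Fin L) (h : n i.succ j.castSucc = n i.castSucc j.succ) :
    0 ≤ n i.succ j.castSucc ∧ n i.succ j.castSucc + 1 ≤ L := by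
  -- Distances from the lower, left and upper boundaries bound the heights.
  have h1 : ∀ i j : Fin (L + 1), |n i j - (L - j)| ≤ i := by
    intro i j
    induction i using Fin.induction with
    | zero => simp [hn.first_row]
    | succ i ih =>
      have := hn.step_row i j
      have := abs_sub_le (n i.succ j) (n i.castSucc j) (L - j)
      simp only [Fin.val_castSucc, Fin.val_succ] at ih ⊢
      push_cast
      linarith
  have h2 : ∀ i j : Fin (L + 1), |n i j - (L - i)| ≤ j := by
    intro i j
    induction j using Fin.induction with
    | zero => simp [hn.first_col]
    | succ j ih =>
      have := hn.step_col i j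
      have := abs_sub_le (n i j.succ) (n i j.castSucc) (L - i)
      simp only [Fin.val_castSucc, Fin.val_succ] at ih ⊢
      push_cast
      linarith
  have h3 : ∀ i j : Fin (L + 1), |n i j - j| ≤ L - i := by
    intro i j
    induction i using Fin.reverseInduction with
    | last => simp [hn.last_row]
    | cast i ih =>
      have := hn.step_row i j
      have := abs_sub_le (n i.castSucc j) (n i.succ j) j
      rw [abs_sub_comm (n i.castSucc j) (n i.succ j)] at this
      simp only [Fin.val_castSucc, Fin.val_succ] at ih ⊢
      push_cast at ih
      linarith
  have e1 := abs_le.1 (h1 i.succ j.castSucc)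
  have e2 := abs_le.1 (h1 i.castSucc j.succ)
  have e3 := abs_le.1 (h2 i.succ j.castSucc)
  have e4 := abs_le.1 (h3 i.succ j.castSucc)
  simp only [Fin.val_castSucc, Fin.val_succ] at e1 e2 e3 e4
  push_cast at e1 e2 e3 e4
  omega

theorem continuousAt_weight (hp0 : 0 < p) (hp1 : p < 1) (u : ℂ) (a b c d : ℤ)
    (h : a = d → theta p (τ + ((a : ℂ) + 1) * γ) ≠ 0) :
    ContinuousAt (fun t => weight p γ t u a b c d) τ := by
  have hc := continuous_theta hp0 hp1
  have hs : ∀ c : ℂ, ContinuousAt (fun t => theta p (t + c)) τ := fun c =>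
    (hc.comp (continuous_id.add continuous_const)).continuousAt
  unfold weight
  split_ifs with h1 h2
  · exact continuousAt_const
  · refine ContinuousAt.div (ContinuousAt.mul ?_ continuousAt_const) (hs _) (h (not_not.1 h1))
    simp only [add_assoc]
    exact hs _
  · refine ContinuousAt.div (ContinuousAt.mul ?_ continuousAt_const) (hs _) (h (not_not.1 h1))
    simp only [add_assoc]
    exact hs _

theorem continuousAt_Z (hp0 : 0 < p) (hp1 : p < 1) {L : ℕ} (x μ : Fin L → ℂ)
    (hτ : ∀ k : ℕ, 1 ≤ k → k ≤ L → theta p (τ + k * γ) ≠ 0) :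
    ContinuousAt (fun t => Z p γ t x μ) τ := by
  unfold Z
  refine tendsto_finsetSum _ fun n hn => tendsto_finsetProd _ fun i _ =>
    tendsto_finsetProd _ fun j _ => continuousAt_weight hp0 hp1 _ _ _ _ _ fun h => ?_
  rw [Set.Finite.mem_toFinset, Set.mem_ofPred_eq] at hn
  obtain ⟨h0, h1⟩ := hn.bounds_of_eq i j h
  have := hτ (n i.succ j.castSucc + 1).toNat (by omega) (by omega)
  rwa [← Int.cast_natCast, Int.toNat_of_nonneg (by omega), Int.cast_add, Int.cast_one] at this

theorem continuousAt_coeffN (hp0 : 0 < p) (hp1 : p < 1) {L : ℕ} (x μ : Fin L → ℂ) (y : ℂ)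
    (i : Fin L) (hτ : theta p (τ + γ) ≠ 0) (hy : theta p (x i - y) ≠ 0) :
    ContinuousAt (fun t => coeffN p γ t x μ y i) τ := by
  have hc := continuous_theta hp0 hp1
  unfold coeffN
  refine ContinuousAt.mul (ContinuousAt.mul (ContinuousAt.div ?_ ?_ (mul_ne_zero hτ hy))
    continuousAt_const) continuousAt_const
  · exact Continuous.continuousAt (by fun_prop)
  · exact Continuous.continuousAt (by fun_prop)

/-- By the identity theorem and the Baire category theorem. -/
theorem dense_generic (hp0 : 0 < p) (hp1 : p < 1) {z : ℂ} (hz : theta p z ≠ 0) (γ : ℂ) :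
    Dense {t : ℂ | ∀ k : ℤ, theta p (t + k * γ) ≠ 0} := by
  have hc := continuous_theta hp0 hp1
  rw [Set.ofPred_forall]
  refine dense_iInter_of_isOpen (fun k => isOpen_ne_fun (by fun_prop) continuous_const) fun k => ?_
  exact (dense_theta_ne_zero hp0 hp1 hz).preimage (Homeomorph.addRight (k * γ)).isOpenMap

end SOS

theorem lemma1 (p : ℝ) (hp0 : 0 < p) (hp1 : p < 1) (L : ℕ) (γ τ : ℂ) (x μ : Fin L → ℂ)
    (x₀ x₀' : ℂ)
    (hτ : ∀ k : ℕ, 1 ≤ k → k ≤ L → SOS.theta p (τ + k * γ) ≠ 0)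
    (hx : ∀ i j : Fin L, i ≠ j → SOS.theta p (x i - x j) ≠ 0)
    (hx₀ : ∀ j : Fin L, SOS.theta p (x j - x₀) ≠ 0)
    (hx₀' : ∀ j : Fin L, SOS.theta p (x j - x₀') ≠ 0)
    (hμ₀ : ∀ j : Fin L, SOS.theta p (x₀ - μ j) ≠ 0)
    (hμ₀' : ∀ j : Fin L, SOS.theta p (x₀' - μ j) ≠ 0) :
    SOS.coeffM p γ x μ x₀ x₀' * SOS.Z p γ τ x μ +
      ∑ i : Fin L, SOS.coeffN p γ τ x μ x₀ i * SOS.Z p γ τ (Function.update x i x₀) μ +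
      ∑ i : Fin L, SOS.coeffNbar p γ τ x μ x₀' i * SOS.Z p γ τ (Function.update x i x₀') μ = 0 := by
  -- For `L = 0` both products in `coeffM` are empty. Otherwise `[τ + γ] ≠ 0` shows `[·] ≢ 0`.
  rcases Nat.eq_zero_or_pos L with rfl | hL
  · simp [SOS.coeffM]
  have h1 : SOS.theta p (τ + γ) ≠ 0 := by simpa using hτ 1 le_rfl hL
  have hZ := fun y : Fin L → ℂ => SOS.continuousAt_Z (γ := γ) hp0 hp1 y μ hτ
  have hdense := SOS.dense_generic hp0 hp1 h1 γ
  simp only [SOS.coeffNbar_eq_neg_coeffN hp0]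
  have hcont : ContinuousAt (fun t => SOS.coeffM p γ x μ x₀ x₀' * SOS.Z p γ t x μ +
      ∑ i : Fin L, SOS.coeffN p γ t x μ x₀ i * SOS.Z p γ t (Function.update x i x₀) μ +
      ∑ i : Fin L, -SOS.coeffN p γ t x μ x₀' i * SOS.Z p γ t (Function.update x i x₀') μ) τ := by
    refine ContinuousAt.add (ContinuousAt.add (continuousAt_const.mul (hZ x)) ?_) ?_
    · exact tendsto_finsetSum _ fun i _ =>
        (SOS.continuousAt_coeffN hp0 hp1 x μ x₀ i h1 (hx₀ i)).mul (hZ _)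
    · exact tendsto_finsetSum _ fun i _ =>
        (SOS.continuousAt_coeffN hp0 hp1 x μ x₀' i h1 (hx₀' i)).neg.mul (hZ _)
  -- For `t` with all `[t + k γ] ≠ 0` the identity holds; such `t` accumulate at `τ`.
  have : (nhdsWithin τ {t : ℂ | ∀ k : ℤ, SOS.theta p (t + k * γ) ≠ 0}).NeBot :=
    mem_closure_iff_nhdsWithin_neBot.1 (hdense τ)
  refine tendsto_nhds_unique (l := nhdsWithin τ {t : ℂ | ∀ k : ℤ, SOS.theta p (t + k * γ) ≠ 0})
    (hcont.tendsto.mono_left nhdsWithin_le_nhds)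
    (tendsto_const_nhds.congr' (eventually_nhdsWithin_of_forall fun t ht => ?_))
  have h := SOS.functional_equation_of_generic hp0 hp1 ht x μ x₀ x₀' hx hx₀ hx₀' hμ₀ hμ₀'
  simp only [SOS.coeffNbar_eq_neg_coeffN hp0] at h
  exact h.symm
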